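/- Let $\mathcal I_1,\mathcal I_2\subset\mathbb R$ be compact, and let $(Y_i(\cdot),X_i(\cdot))$, $i\ge 1$, be a sequence of pairs of random curves with $Y_i\in L_2(\mathcal I_1)$, $X_i\in L_2(\mathcal I_2)$, $\mathbb E\,Y_i(u)=0$ for all $u\in\mathcal I_1$ and $\mathbb E\,X_i(v)=0$ for all $v\in\mathcal I_2$. Suppose that the sequence $\{(Y_i,X_i)\}$, viewed in $L_2(\mathcal I_1)\times L_2(\mathcal I_2)$, is strictly stationary and $\psi$-mixing, with mixing coefficients $$\psi(k)=\sup_{m}\ \sup_{A,B}\left|1-\frac{P(B\mid A)}{P(B)}\right|,$$ where the inner supremum is over events $A\in\sigma\{(Y_i,X_i):i\le m\}$ and $B\in\sigma\{(Y_i,X_i):i\ge m+k\}$ with $P(A)P(B)>0$ ($\psi$-mixing means $\psi(k)\to0$). Suppose that $\sum_{k\ge1}k\,\psi(k)^{1/2}<\infty$ and $$\mathbb E\Big\{\int_{\mathcal I_1}Y_i(u)^2\,du+\int_{\mathcal I_2}X_i(v)^2\,dv\Big\}^2<\infty .$$ Let $\Sigma(u,v)=\operatorname{cov}\{Y_i(u),X_i(v)\}$,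 and let $\lambda_1\ge\lambda_2\ge\cdots\ge0$ be the eigenvalues, counted with multiplicity and continued by zeros if there are only finitely many positive ones, of the integral operator on $L_2(\mathcal I_1)$ with kernel $M_1(u,u')=\int_{\mathcal I_2}\Sigma(u,z)\Sigma(u',z)\,dz$ (so $\lambda_k$ is the square of the $k$-th largest singular value of $\Sigma$). For $n\ge1$ let $$\widehat\Sigma(u,v)=\frac1n\sum_{i=1}^n\{Y_i(u)-\bar Y(u)\}\{X_i(v)-\bar X(v)\},\qquad \bar Y=\frac1n\sum_{i=1}^nY_i,\quad \bar X=\frac1n\sum_{i=1}^nX_i,$$ and let $\widehat\lambda_1\ge\widehat\lambda_2\ge\cdots\ge0$ be the eigenvalues obtained in the same way from $\widehat M_1(u,u')=\int_{\mathcal I_2}\widehat\Sigma(u,z)\widehat\Sigma(u',z)\,dz$. Assume that for some integer $r\ge0$, $\lambda_1>\cdots>\lambda_r>0=\lambda_{r+1}=\lambda_{r+2}=\cdots$. Then, as $n\to\infty$, (i) $|\widehat\lambda_k-\lambda_k|=O_p(n^{-1/2})$ for each $1\le k\le r$, and (ii) $|\widehat\lambda_k|=O_p(n^{-1})$ for each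 $k>r$. -/

import Mathlib

open MeasureTheory ProbabilityTheory Filter Topology
open scoped ENNReal

-- A subset of `ℝ` carries the restriction of Lebesgue measure.
attribute [local instance] MeasureTheory.Measure.Subtype.measureSpace

noncomputable section

namespace CurveRegression

/-- The Hilbert space of (classes of) square integrable real curves on `S`. -/
abbrev L2 (S : Type*) [MeasureSpace S] : Type _ := Lp ℝ 2 (volume : Measure S)

/-- `L2 S` carries its Borel σ-algebra. -/
instance instMeasurableSpaceL2 (S : Type*) [MeasureSpace S] : MeasurableSpace (L2 S) :=
  borel (L2 S)

instance instBorelSpaceL2 (S : Type*) [MeasureSpace S] : BorelSpace (L2 S) := ⟨rfl⟩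

/-- A random curve on `S`: a jointly measurable real process indexed by `S` whose sample paths
are square integrable. -/
structure RandomCurve (Ω S : Type*) [MeasurableSpace Ω] [MeasureSpace S] where
  /-- The value of the curve at `ω` and `u`. -/
  toFun : Ω → S → ℝ
  measurable_uncurry : Measurable (Function.uncurry toFun)
  memLp : ∀ ω, MemLp (toFun ω) 2 (volume : Measure S)

instance instCoeFunRandomCurve (Ω S : Type*) [MeasurableSpace Ω] [MeasureSpace S] :
    CoeFun (RandomCurve Ω S) (fun _ => Ω → S → ℝ) := ⟨RandomCurve.toFun⟩

/-- The random curve as a random element of the Hilbert space `L2 S`. -/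
def RandomCurve.toL2 {Ω S : Type*} [MeasurableSpace Ω] [MeasureSpace S]
    (Y : RandomCurve Ω S) (ω : Ω) : L2 S :=
  (Y.memLp ω).toLp (Y ω)

/-- The sequence of pairs of curves `(Y_i, X_i)`, as random elements of `L2 S × L2 T`. -/
def curvePair {Ω S T : Type*} [MeasurableSpace Ω] [MeasureSpace S] [MeasureSpace T]
    (Y : ℕ → RandomCurve Ω S) (X : ℕ → RandomCurve Ω T) (i : ℕ) (ω : Ω) : L2 S × L2 T :=
  ((Y i).toL2 ω, (X i).toL2 ω)

/-! ### Stationarity and mixing -/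

/-- Strict stationarity: all time shifts of the whole sequence have the same law. -/
def IsStrictlyStationary {Ω E : Type*} [MeasurableSpace Ω] [MeasurableSpace E]
    (Z : ℕ → Ω → E) (μ : Measure Ω) : Prop :=
  ∀ h : ℕ, IdentDistrib (fun ω i => Z (i + h) ω) (fun ω i => Z i ω) μ μ

/-- The σ-algebra generated by `Z_i`, `i ≤ m`. -/
@[reducible] def pastSigma {Ω E : Type*} [MeasurableSpace E] (Z : ℕ → Ω → E) (m : ℕ) : MeasurableSpace Ω :=
  ⨆ i : ℕ, ⨆ _ : i ≤ m, MeasurableSpace.comap (Z i) inferInstance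

/-- The σ-algebra generated by `Z_i`, `i ≥ m`. -/
@[reducible] def futureSigma {Ω E : Type*} [MeasurableSpace E] (Z : ℕ → Ω → E) (m : ℕ) : MeasurableSpace Ω :=
  ⨆ i : ℕ, ⨆ _ : m ≤ i, MeasurableSpace.comap (Z i) inferInstance

/-- The ψ-mixing coefficient
`ψ(k) = sup |1 - P(B | A) / P(B)|`, over `m`, over events `A` of the past up to time `m` and
events `B` of the future from time `m + k`, both of positive probability. It may be infinite. -/
def psiCoeff {Ω E : Type*} [MeasurableSpace Ω] [MeasurableSpace E]
    (Z : ℕ → Ω → E) (μ : Measure Ω) (k : ℕ) : ℝ≥0∞ :=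
  ⨆ (m : ℕ) (A : Set Ω) (B : Set Ω)
    (_ : MeasurableSet[pastSigma Z m] A) (_ : MeasurableSet[futureSigma Z (m + k)] B)
    (_ : 0 < μ A) (_ : 0 < μ B),
    ENNReal.ofReal |1 - (μ[|A]).real B / μ.real B|

/-- ψ-mixing: the ψ-mixing coefficients tend to zero. -/
def IsPsiMixing {Ω E : Type*} [MeasurableSpace Ω] [MeasurableSpace E]
    (Z : ℕ → Ω → E) (μ : Measure Ω) : Prop :=
  Tendsto (psiCoeff Z μ) atTop (𝓝 0)

/-! ### Covariance kernels and their eigenvalues -/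

/-- The covariance kernel `Σ(u, v) = cov(Y(u), X(v))`. -/
def covKernel {Ω S T : Type*} [MeasurableSpace Ω] [MeasureSpace S] [MeasureSpace T]
    (μ : Measure Ω) (Y : RandomCurve Ω S) (X : RandomCurve Ω T) (u : S) (v : T) : ℝ :=
  cov[fun ω => Y ω u, fun ω => X ω v; μ]

/-- The mean of the first `n` curves, at `ω` and `u`. -/
def sampleMean {Ω S : Type*} [MeasurableSpace Ω] [MeasureSpace S]
    (Y : ℕ → RandomCurve Ω S) (n : ℕ) (ω : Ω) (u : S) : ℝ :=
  (n : ℝ)⁻¹ * ∑ i ∈ Finset.range n, Y i ω u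

/-- The sample covariance kernel of the first `n` pairs of curves, at `ω` and `(u, v)`. -/
def sampleCovKernel {Ω S T : Type*} [MeasurableSpace Ω] [MeasureSpace S] [MeasureSpace T]
    (Y : ℕ → RandomCurve Ω S) (X : ℕ → RandomCurve Ω T) (n : ℕ) (ω : Ω) (u : S) (v : T) : ℝ :=
  (n : ℝ)⁻¹ * ∑ i ∈ Finset.range n,
    (Y i ω u - sampleMean Y n ω u) * (X i ω v - sampleMean X n ω v)

/-- The kernel `M₁(u, u') = ∫ Σ(u, z) Σ(u', z) dz` attached to a kernel `Σ`. -/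
def gramKernel {S T : Type*} [MeasureSpace T] (K : S → T → ℝ) (u u' : S) : ℝ :=
  ∫ z, K u z * K u' z

/-- `f` satisfies `∫ M(u, z) f(z) dz = s f(u)` for almost every `u`: it is zero or an
eigenfunction, with eigenvalue `s`, of the integral operator with kernel `M`. -/
def IsEigenfunction {S : Type*} [MeasureSpace S] (M : S → S → ℝ) (s : ℝ) (f : L2 S) : Prop :=
  ∀ᵐ u, ∫ z, M u z * f z = s * f u

/-- The span of all eigenfunctions belonging to eigenvalues `s ≥ t`; its dimension is the number
of eigenvalues `≥ t`, counted with multiplicity. -/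
def eigenSpan {S : Type*} [MeasureSpace S] (M : S → S → ℝ) (t : ℝ) : Submodule ℝ (L2 S) :=
  Submodule.span ℝ {f | ∃ s, t ≤ s ∧ IsEigenfunction M s f}

/-- The `k`-th largest eigenvalue (`k = 1, 2, …`, counted with multiplicity) of the non-negative
compact integral operator on `L2 S` with kernel `M`: the largest `t > 0` such that at least `k`
eigenvalues are `≥ t`, and `0` if there are fewer than `k` positive eigenvalues. -/
def kthEigenvalue {S : Type*} [MeasureSpace S] (M : S → S → ℝ) (k : ℕ) : ℝ :=
  sSup {t : ℝ | 0 < t ∧ (k : Cardinal) ≤ Module.rank ℝ (eigenSpan M t)}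

/-- `λ_k`, `k = 1, 2, …`: the `k`-th largest eigenvalue of `M₁`, that is, the square of the
`k`-th largest singular value of `Σ`. -/
def lam {Ω S T : Type*} [MeasurableSpace Ω] [MeasureSpace S] [MeasureSpace T]
    (μ : Measure Ω) (Y : RandomCurve Ω S) (X : RandomCurve Ω T) (k : ℕ) : ℝ :=
  kthEigenvalue (gramKernel (covKernel μ Y X)) k

/-- The estimator of `λ_k` from the first `n` pairs of curves. -/
def lamHat {Ω S T : Type*} [MeasurableSpace Ω] [MeasureSpace S] [MeasureSpace T]
    (Y : ℕ → RandomCurve Ω S) (X : ℕ → RandomCurve Ω T) (n k : ℕ) (ω : Ω) : ℝ :=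
  kthEigenvalue (gramKernel (sampleCovKernel Y X n ω)) k

/-! ### Stochastic order -/

/-- `W_n = O_p(a_n)`: for every `ε > 0` there is a constant `C` such that
`P(|W_n| > C a_n) ≤ ε` for all large `n`. -/
def IsBigOp {Ω : Type*} [MeasurableSpace Ω] (μ : Measure Ω) (W : ℕ → Ω → ℝ) (a : ℕ → ℝ) : Prop :=
  ∀ ε : ℝ≥0∞, 0 < ε → ∃ C : ℝ, 0 < C ∧ ∀ᶠ n in atTop, μ {ω | C * a n < |W n ω|} ≤ ε

end CurveRegression

end

open CurveRegression

namespace CurveRegression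

section Hilbert

open scoped InnerProductSpace
open ContinuousLinearMap Module.End

variable {H H' : Type*} [NormedAddCommGroup H] [InnerProductSpace ℝ H]
  [NormedAddCommGroup H'] [InnerProductSpace ℝ H']

/-- The span of the eigenvectors of `N` belonging to eigenvalues `s ≥ t`. -/
def opEigenSpan (N : H →L[ℝ] H) (t : ℝ) : Submodule ℝ H :=
  Submodule.span ℝ {f | ∃ s, t ≤ s ∧ N f = s • f}

/-- The `k`-th largest positive eigenvalue of `N`, or zero. -/
noncomputable def opEigenvalue (N : H →L[ℝ] H) (k : ℕ) : ℝ :=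
  sSup {t : ℝ | 0 < t ∧ (k : Cardinal) ≤ Module.rank ℝ (opEigenSpan N t)}

theorem opEigenvalue_nonneg (N : H →L[ℝ] H) (k : ℕ) : 0 ≤ opEigenvalue N k :=
  Real.sSup_nonneg fun _ ht => ht.1.le

theorem le_inner_of_mem_opEigenSpan {N : H →L[ℝ] H} (hN : N.IsSymmetric) {t : ℝ} {f : H}
    (hf : f ∈ opEigenSpan N t) : t * ‖f‖ ^ 2 ≤ ⟪N f, f⟫_ℝ := by
  classical
  have hle : opEigenSpan N t ≤ ⨆ s : Set.Ici t, eigenspace (N : Module.End ℝ H) s.1 := by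
    refine Submodule.span_le.2 ?_
    rintro g ⟨s, hs, hg⟩
    exact Submodule.mem_iSup_of_mem (⟨s, hs⟩ : Set.Ici t) (mem_eigenspace_iff.2 hg)
  obtain ⟨φ, hφ, rfl⟩ := (Submodule.mem_iSup_iff_exists_finsupp _ _).1 (hle hf)
  have horth : ∀ i j : Set.Ici t, i ≠ j → ⟪φ i, φ j⟫_ℝ = 0 := fun i j hij =>
    hN.orthogonalFamily_eigenspaces (fun h => hij (Subtype.ext h)) ⟨φ i, hφ i⟩ ⟨φ j, hφ j⟩
  have hNφ : ∀ i, N (φ i) = (i : ℝ) • φ i := fun i => mem_eigenspace_iff.1 (hφ i)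
  have key : ∀ c : Set.Ici t → ℝ,
      ⟪∑ i ∈ φ.support, c i • φ i, ∑ i ∈ φ.support, φ i⟫_ℝ
        = ∑ i ∈ φ.support, c i * ‖φ i‖ ^ 2 := by
    intro c
    rw [sum_inner]
    refine Finset.sum_congr rfl fun i hi => ?_
    rw [inner_sum, Finset.sum_eq_single i]
    · rw [real_inner_smul_left, real_inner_self_eq_norm_sq]
    · intro j _ hji
      rw [real_inner_smul_left, horth i j hji.symm, mul_zero]
    · exact fun h => absurd hi h
  have h1 := key fun _ => 1
  have h2 := key fun i => (i : ℝ)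
  simp only [one_smul, one_mul] at h1
  rw [Finsupp.sum, map_sum, ← real_inner_self_eq_norm_sq, h1, Finset.mul_sum]
  simp only [hNφ]
  rw [h2]
  exact Finset.sum_le_sum fun i _ => mul_le_mul_of_nonneg_right i.2 (sq_nonneg _)

theorem exists_eigenvalue_eq_norm [CompleteSpace H] {N : H →L[ℝ] H} (hN : N.IsPositive)
    (hc : IsCompactOperator N) (h0 : N ≠ 0) :
    HasEigenvalue (N : Module.End ℝ H) ‖N‖ := by
  have hsr := N.spectralRadius_eq_nnnorm hN.isSelfAdjoint
  have hne : (spectrum ℝ N).Nonempty := by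
    by_contra hemp
    rw [Set.not_nonempty_iff_eq_empty] at hemp
    rw [spectralRadius, hemp] at hsr
    simp at hsr
    exact h0 (nnnorm_eq_zero.1 hsr.symm)
  obtain ⟨z, hz, hzn⟩ := spectrum.exists_nnnorm_eq_spectralRadius_of_nonempty hne
  rw [hsr] at hzn
  have hzn' : ‖z‖ = ‖N‖ := by
    have := ENNReal.coe_injective hzn
    exact congrArg NNReal.toReal this
  have hz0 : z ≠ 0 := by
    rintro rfl
    rw [norm_zero] at hzn'
    exact h0 (norm_eq_zero.1 hzn'.symm)
  have hev := (hc.hasEigenvalue_iff_mem_spectrum hz0).2 hz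
  have hz1 : 0 ≤ z := by
    refine eigenvalue_nonneg_of_nonneg hev fun x => ?_
    exact hN.inner_nonneg_right x
  rw [Real.norm_of_nonneg hz1] at hzn'
  rwa [← hzn']

theorem inner_le_of_mem_orthogonal_opEigenSpan [CompleteSpace H] {N : H →L[ℝ] H}
    (hN : N.IsPositive) (hc : IsCompactOperator N) {t : ℝ} (ht : 0 < t) {f : H}
    (hf : f ∈ (opEigenSpan N t)ᗮ) : ⟪N f, f⟫_ℝ ≤ t * ‖f‖ ^ 2 := by
  have hmap : ∀ g ∈ opEigenSpan N t, N g ∈ opEigenSpan N t := by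
    intro g hg
    refine Submodule.span_induction (p := fun x _ => N x ∈ opEigenSpan N t) ?_ ?_ ?_ ?_ hg
    · rintro x ⟨s, hs, hx⟩
      rw [hx]
      exact Submodule.smul_mem _ _ (Submodule.subset_span ⟨s, hs, hx⟩)
    · simp
    · intro x y _ _ hx hy
      rw [map_add]
      exact Submodule.add_mem _ hx hy
    · intro a x _ hx
      rw [map_smul]
      exact Submodule.smul_mem _ _ hx
  have hinv : ∀ g ∈ (opEigenSpan N t)ᗮ, N g ∈ (opEigenSpan N t)ᗮ := by
    intro g hg
    rw [Submodule.mem_orthogonal] at hg ⊢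
    intro u hu
    have := hN.isSymmetric u g
    exact this.symm.trans (hg _ (hmap u hu))
  let W := (opEigenSpan N t)ᗮ
  let S : W →L[ℝ] W := N.restrict hinv
  have hSc : IsCompactOperator S := hc.restrict' hinv
  have hSp : S.IsPositive := by
    refine ⟨hN.isSymmetric.restrict_invariant hinv, fun x => ?_⟩
    exact hN.2 (x : H)
  have hnorm : ‖S‖ ≤ t := by
    by_contra! hlt
    have hS0 : S ≠ 0 := by
      intro h
      have hS : ‖S‖ = 0 := by rw [h]; exact opNorm_zero
      linarith
    obtain ⟨w, hw⟩ := (exists_eigenvalue_eq_norm hSp hSc hS0).exists_hasEigenvector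
    have hNw : N (w : H) = ‖S‖ • (w : H) := by
      have := mem_eigenspace_iff.1 hw.1
      exact congrArg Subtype.val this
    have hmem : (w : H) ∈ opEigenSpan N t := Submodule.subset_span ⟨_, hlt.le, hNw⟩
    have h0 : ⟪(w : H), (w : H)⟫_ℝ = 0 := (Submodule.mem_orthogonal _ _).1 w.2 _ hmem
    exact hw.2 (Subtype.ext (inner_self_eq_zero.1 h0))
  calc ⟪N f, f⟫_ℝ = ⟪S ⟨f, hf⟩, (⟨f, hf⟩ : W)⟫_ℝ := rfl
    _ ≤ ‖S ⟨f, hf⟩‖ * ‖(⟨f, hf⟩ : W)‖ := real_inner_le_norm _ _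
    _ ≤ (‖S‖ * ‖(⟨f, hf⟩ : W)‖) * ‖(⟨f, hf⟩ : W)‖ := by gcongr; exact S.le_opNorm _
    _ = ‖S‖ * ‖f‖ ^ 2 := by rw [pow_two, mul_assoc]; rfl
    _ ≤ t * ‖f‖ ^ 2 := by gcongr

theorem exists_ne_zero_mem_orthogonal_of_rank_lt {V W : Submodule ℝ H} {k : ℕ}
    (hV : (k : Cardinal) ≤ Module.rank ℝ V) (hW : Module.rank ℝ W < (k : Cardinal)) :
    ∃ f ∈ V, f ≠ 0 ∧ f ∈ Wᗮ := by
  have : FiniteDimensional ℝ W :=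
    Module.rank_lt_aleph0_iff.1 (hW.trans Cardinal.natCast_lt_aleph0)
  let P : V →ₗ[ℝ] W := (W.orthogonalProjectionOnto : H →ₗ[ℝ] W) ∘ₗ V.subtype
  have hP : ¬ Function.Injective P := fun h =>
    ((LinearMap.rank_le_of_injective P h).trans_lt hW).not_ge hV
  rw [← LinearMap.ker_eq_bot, ← ne_eq, Submodule.ne_bot_iff] at hP
  obtain ⟨f, hf, hf0⟩ := hP
  refine ⟨f, f.2, fun h => hf0 (Subtype.ext h), ?_⟩
  exact Submodule.orthogonalProjectionOnto_eq_zero_iff.1 (LinearMap.mem_ker.1 hf)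

variable [CompleteSpace H] [CompleteSpace H']

theorem inner_adjoint_comp_self (A : H →L[ℝ] H') (f : H) :
    ⟪(adjoint A ∘L A) f, f⟫_ℝ = ‖A f‖ ^ 2 := by
  rw [comp_apply, adjoint_inner_left, real_inner_self_eq_norm_sq]

theorem isPositive_adjoint_comp (A : H →L[ℝ] H') : (adjoint A ∘L A).IsPositive :=
  isPositive_adjoint_comp_self A

theorem bddAbove_opEigenvalue (A : H →L[ℝ] H') {k : ℕ} (hk : 1 ≤ k) :
    BddAbove {t : ℝ | 0 < t ∧ (k : Cardinal) ≤ Module.rank ℝ (opEigenSpan (adjoint A ∘L A) t)} := by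
  refine ⟨‖A‖ ^ 2, ?_⟩
  rintro t ⟨ht, hr⟩
  obtain ⟨f, hf, hf0, -⟩ := exists_ne_zero_mem_orthogonal_of_rank_lt (W := (⊥ : Submodule ℝ H)) hr
    (by rw [rank_bot]; exact_mod_cast hk)
  have h1 := le_inner_of_mem_opEigenSpan (isPositive_adjoint_comp A).isSymmetric hf
  rw [inner_adjoint_comp_self] at h1
  have h2 : ‖A f‖ ^ 2 ≤ ‖A‖ ^ 2 * ‖f‖ ^ 2 := by
    rw [← mul_pow]
    gcongr
    exact A.le_opNorm f
  have h3 : 0 < ‖f‖ ^ 2 := by positivity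
  exact le_of_mul_le_mul_right (h1.trans h2) h3

/-- Weyl's inequality for singular values. -/
theorem sqrt_opEigenvalue_le (A B : H →L[ℝ] H') (hB : IsCompactOperator B) {k : ℕ} (hk : 1 ≤ k) :
    √(opEigenvalue (adjoint A ∘L A) k) ≤ √(opEigenvalue (adjoint B ∘L B) k) + ‖A - B‖ := by
  set b := opEigenvalue (adjoint B ∘L B) k
  have hb : 0 ≤ b := opEigenvalue_nonneg _ _
  have hBc : IsCompactOperator (adjoint B ∘L B) := by
    rw [coe_comp]
    exact hB.clm_comp (adjoint B)
  have main : ∀ t ∈ {t : ℝ | 0 < t ∧ (k : Cardinal) ≤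
      Module.rank ℝ (opEigenSpan (adjoint A ∘L A) t)}, ∀ s, b < s → √t ≤ √s + ‖A - B‖ := by
    rintro t ⟨ht, hr⟩ s hs
    have hs0 : 0 < s := hb.trans_lt hs
    have hrs : Module.rank ℝ (opEigenSpan (adjoint B ∘L B) s) < (k : Cardinal) := by
      by_contra! h
      exact hs.not_ge (le_csSup (bddAbove_opEigenvalue B hk) ⟨hs0, h⟩)
    obtain ⟨f, hf, hf0, hfo⟩ := exists_ne_zero_mem_orthogonal_of_rank_lt hr hrs
    have h1 := le_inner_of_mem_opEigenSpan (isPositive_adjoint_comp A).isSymmetric hf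
    have h2 := inner_le_of_mem_orthogonal_opEigenSpan (isPositive_adjoint_comp B) hBc hs0 hfo
    rw [inner_adjoint_comp_self] at h1 h2
    have hfp : 0 < ‖f‖ := norm_pos_iff.2 hf0
    have h1' : √t * ‖f‖ ≤ ‖A f‖ := by
      refine le_of_sq_le_sq ?_ (norm_nonneg _)
      rwa [mul_pow, Real.sq_sqrt ht.le]
    have h2' : ‖B f‖ ≤ √s * ‖f‖ := by
      refine le_of_sq_le_sq ?_ (by positivity)
      rwa [mul_pow, Real.sq_sqrt hs0.le]
    have h3 : ‖A f‖ ≤ ‖B f‖ + ‖A - B‖ * ‖f‖ := by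
      have e : A f = B f + (A - B) f := by simp
      rw [e]
      exact (norm_add_le _ _).trans (by gcongr; exact (A - B).le_opNorm f)
    refine le_of_mul_le_mul_right ?_ hfp
    rw [add_mul]
    linarith
  have main' : ∀ t ∈ {t : ℝ | 0 < t ∧ (k : Cardinal) ≤
      Module.rank ℝ (opEigenSpan (adjoint A ∘L A) t)}, √t ≤ √b + ‖A - B‖ := by
    intro t ht
    have hlim : Tendsto (fun s => √s + ‖A - B‖) (𝓝[>] b) (𝓝 (√b + ‖A - B‖)) :=
      ((Real.continuous_sqrt.add continuous_const).tendsto b).mono_left nhdsWithin_le_nhds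
    exact ge_of_tendsto hlim (eventually_mem_nhdsWithin.mono fun s hs => main t ht s hs)
  refine Real.sqrt_le_iff.2 ⟨by positivity, ?_⟩
  refine Real.sSup_le (fun t ht => ?_) (by positivity)
  rw [← Real.sq_sqrt ht.1.le]
  exact pow_le_pow_left₀ (Real.sqrt_nonneg _) (main' t ht) 2

theorem abs_sqrt_opEigenvalue_sub_le (A B : H →L[ℝ] H') (hA : IsCompactOperator A)
    (hB : IsCompactOperator B) {k : ℕ} (hk : 1 ≤ k) :
    |√(opEigenvalue (adjoint A ∘L A) k) - √(opEigenvalue (adjoint B ∘L B) k)| ≤ ‖A - B‖ := by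
  have h1 := sqrt_opEigenvalue_le A B hB hk
  have h2 := sqrt_opEigenvalue_le B A hA hk
  rw [norm_sub_rev] at h2
  rw [abs_le]
  constructor <;> linarith

end Hilbert

section Kernels

open scoped InnerProductSpace
open ContinuousLinearMap InnerProductSpace

theorem memLp_two_mul_prod {α β : Type*} [MeasurableSpace α] [MeasurableSpace β]
    {μ : Measure α} {ν : Measure β} [SFinite μ] [SFinite ν] {f : α → ℝ} {g : β → ℝ}
    (hf : MemLp f 2 μ) (hg : MemLp g 2 ν) :
    MemLp (fun p : α × β => f p.1 * g p.2) 2 (μ.prod ν) := by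
  refine (memLp_two_iff_integrable_sq ?_).2 ?_
  · exact hf.1.comp_fst.mul hg.1.comp_snd
  · refine (hf.integrable_sq.mul_prod hg.integrable_sq).congr (ae_of_all _ fun p => ?_)
    simp only [mul_pow]

variable {S T : Type*} [MeasureSpace S] [MeasureSpace T]

theorem inner_toLp {a : S → ℝ} (ha : MemLp a 2 (volume : Measure S)) (f : L2 S) :
    ⟪ha.toLp a, f⟫_ℝ = ∫ u, a u * f u := by
  rw [L2.inner_def]
  refine integral_congr_ae ?_
  filter_upwards [ha.coeFn_toLp] with u hu
  rw [hu, real_inner_eq_re_inner, RCLike.inner_apply]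
  simp [mul_comm]

/-- `A` is the integral operator `f ↦ ∫ K(u, ·) f(u) du` with square integrable kernel `K`. -/
structure IsKernelOf (K : S → T → ℝ) (A : L2 S →L[ℝ] L2 T) : Prop where
  memLp : MemLp (Function.uncurry K) 2 ((volume : Measure S).prod (volume : Measure T))
  inner_eq : ∀ f g, ⟪g, A f⟫_ℝ =
    ∫ p, K p.1 p.2 * (f p.1 * g p.2) ∂((volume : Measure S).prod (volume : Measure T))

theorem IsKernelOf.smul {K : S → T → ℝ} {A : L2 S →L[ℝ] L2 T} (h : IsKernelOf K A)
    (c : ℝ) : IsKernelOf (fun u v => c * K u v) (c • A) := by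
  refine ⟨h.memLp.const_mul c, fun f g => ?_⟩
  rw [smul_apply, real_inner_smul_right, h.inner_eq, ← integral_const_mul]
  simp only [mul_assoc]

theorem IsKernelOf.zero : IsKernelOf (fun (_ : S) (_ : T) => (0 : ℝ)) 0 := by
  refine ⟨MemLp.zero, fun f g => ?_⟩
  simp

theorem isCompactOperator_rankOne {H H' : Type*} [NormedAddCommGroup H] [InnerProductSpace ℝ H]
    [NormedAddCommGroup H'] [InnerProductSpace ℝ H'] (x : H') (y : H) :
    IsCompactOperator (rankOne ℝ x y) := by
  rw [rankOne_def', coe_comp]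
  exact (isCompactOperator_of_locallyCompactSpace_dom (innerSL ℝ y)).clm_comp _

variable {Ω : Type*} [MeasurableSpace Ω]

/-- The sample mean of the first `n` curves, in `L2 S`. -/
noncomputable def meanL2 (Y : ℕ → RandomCurve Ω S) (n : ℕ) (ω : Ω) : L2 S :=
  (n : ℝ)⁻¹ • ∑ i ∈ Finset.range n, (Y i).toL2 ω

/-- The integral operator of the sample covariance kernel. -/
noncomputable def sampleCovOp (Y : ℕ → RandomCurve Ω S) (X : ℕ → RandomCurve Ω T) (n : ℕ) (ω : Ω) :
    L2 S →L[ℝ] L2 T :=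
  (n : ℝ)⁻¹ • ∑ i ∈ Finset.range n, rankOne ℝ ((X i).toL2 ω) ((Y i).toL2 ω)
    - rankOne ℝ (meanL2 X n ω) (meanL2 Y n ω)

theorem sampleCovKernel_eq (Y : ℕ → RandomCurve Ω S) (X : ℕ → RandomCurve Ω T) (n : ℕ) (ω : Ω)
    (u : S) (v : T) : sampleCovKernel Y X n ω u v =
      (n : ℝ)⁻¹ * ∑ i ∈ Finset.range n, Y i ω u * X i ω v
        - sampleMean Y n ω u * sampleMean X n ω v := by
  rcases eq_or_ne n 0 with rfl | hn
  · simp [sampleCovKernel, sampleMean]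
  have hn' : (n : ℝ) ≠ 0 := by exact_mod_cast hn
  have hy : ∑ i ∈ Finset.range n, Y i ω u = n * sampleMean Y n ω u := by
    rw [sampleMean, mul_inv_cancel_left₀ hn']
  have hx : ∑ i ∈ Finset.range n, X i ω v = n * sampleMean X n ω v := by
    rw [sampleMean, mul_inv_cancel_left₀ hn']
  rw [sampleCovKernel]
  have : ∑ i ∈ Finset.range n, (Y i ω u - sampleMean Y n ω u) * (X i ω v - sampleMean X n ω v)
      = ∑ i ∈ Finset.range n, Y i ω u * X i ω v
        - n * (sampleMean Y n ω u * sampleMean X n ω v) := by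
    simp only [sub_mul, mul_sub, Finset.sum_sub_distrib, ← Finset.mul_sum, ← Finset.sum_mul, hy, hx]
    simp
    ring
  rw [this, mul_sub, inv_mul_cancel_left₀ hn']

theorem memLp_sampleMean (Y : ℕ → RandomCurve Ω S) (n : ℕ) (ω : Ω) :
    MemLp (sampleMean Y n ω) 2 (volume : Measure S) := by
  have := (memLp_finsetSum (Finset.range n) fun i _ => (Y i).memLp ω).const_mul (n : ℝ)⁻¹
  exact this

theorem toLp_sampleMean (Y : ℕ → RandomCurve Ω S) (n : ℕ) (ω : Ω) :
    (memLp_sampleMean Y n ω).toLp (sampleMean Y n ω) = meanL2 Y n ω := by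
  rw [Lp.ext_iff]
  refine (MemLp.coeFn_toLp _).trans ?_
  have h1 := Lp.coeFn_smul (n : ℝ)⁻¹ (∑ i ∈ Finset.range n, (Y i).toL2 ω)
  have h2 := Lp.coeFn_finsetSum (Finset.range n) (fun i => (Y i).toL2 ω)
  have h3 : ∀ᵐ u, ∀ i, (Y i).toL2 ω u = Y i ω u :=
    ae_all_iff.2 fun i => ((Y i).memLp ω).coeFn_toLp
  filter_upwards [h1, h2, h3] with u hu1 hu2 hu3
  rw [meanL2, hu1, Pi.smul_apply, hu2, sampleMean]
  simp [hu3]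

theorem isCompactOperator_sampleCovOp (Y : ℕ → RandomCurve Ω S) (X : ℕ → RandomCurve Ω T) (n : ℕ)
    (ω : Ω) : IsCompactOperator (sampleCovOp Y X n ω) := by
  have : sampleCovOp Y X n ω ∈ compactOperator (RingHom.id ℝ) (L2 S) (L2 T) := by
    refine Submodule.sub_mem _ (Submodule.smul_mem _ _ (Submodule.sum_mem _ fun i _ => ?_)) ?_
    · exact isCompactOperator_rankOne _ _
    · exact isCompactOperator_rankOne _ _
  exact this

variable [IsFiniteMeasure (volume : Measure S)] [IsFiniteMeasure (volume : Measure T)]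

namespace IsKernelOf

variable {K : S → T → ℝ} {A : L2 S →L[ℝ] L2 T}

theorem adjoint (h : IsKernelOf K A) : IsKernelOf (fun v u => K u v) (adjoint A) := by
  refine ⟨?_, fun f g => ?_⟩
  · exact h.memLp.comp_measurePreserving Measure.measurePreserving_swap
  · rw [real_inner_comm, adjoint_inner_left, h.inner_eq, ← integral_prod_swap]
    exact integral_congr_ae (ae_of_all _ fun p => by simp [mul_comm])

theorem apply_ae_eq (h : IsKernelOf K A) (f : L2 S) : A f =ᵐ[volume] fun v => ∫ u, K u v * f u := by
  have hint : Integrable (fun p : S × T => K p.1 p.2 * f p.1)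
      ((volume : Measure S).prod (volume : Measure T)) :=
    h.memLp.integrable_mul ((Lp.memLp f).comp_fst _)
  refine Integrable.ae_eq_of_forall_setIntegral_eq _ _
    ((Lp.memLp (A f)).integrable one_le_two) hint.integral_prod_right fun s hs _ => ?_
  rw [← L2.inner_indicatorConstLp_one (𝕜 := ℝ) hs (measure_ne_top _ _), h.inner_eq]
  have hind : Integrable (fun p : S × T => s.indicator (fun v => K p.1 v * f p.1) p.2)
      ((volume : Measure S).prod (volume : Measure T)) := by
    have e : (fun p : S × T => s.indicator (fun v => K p.1 v * f p.1) p.2)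
        = (Prod.snd ⁻¹' s).indicator (fun p : S × T => K p.1 p.2 * f p.1) := by
      ext p
      by_cases hp : p.2 ∈ s <;> simp [hp]
    rw [e]
    exact hint.indicator (measurable_snd hs)
  have hc := (@indicatorConstLp_coeFn T ℝ _ 2 volume _ s hs (measure_ne_top _ _) 1)
  have hc' := Measure.quasiMeasurePreserving_snd (μ := (volume : Measure S)).ae_eq hc
  have e1 : ∫ p : S × T, K p.1 p.2 * (f p.1 *
      (indicatorConstLp 2 hs (measure_ne_top volume s) (1 : ℝ) : L2 T) p.2)
        ∂((volume : Measure S).prod (volume : Measure T))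
      = ∫ p : S × T, s.indicator (fun v => K p.1 v * f p.1) p.2
        ∂((volume : Measure S).prod (volume : Measure T)) := by
    refine integral_congr_ae ?_
    filter_upwards [hc'] with p hp
    simp only [Function.comp_apply] at hp
    rw [hp]
    by_cases hps : p.2 ∈ s <;> simp [hps]
  rw [e1, integral_prod_symm _ hind, ← integral_indicator hs]
  refine integral_congr_ae (ae_of_all _ fun v => ?_)
  by_cases hv : v ∈ s <;> simp [hv]

theorem ae_memLp_fiber (h : IsKernelOf K A) : ∀ᵐ u, MemLp (K u) 2 (volume : Measure T) := by
  have h1 := h.memLp.1.prodMk_left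
  have h2 := h.memLp.integrable_sq.prod_right_ae
  filter_upwards [h1, h2] with u hu1 hu2
  exact (memLp_two_iff_integrable_sq hu1).2 hu2

theorem integral_gramKernel_ae_eq (h : IsKernelOf K A) (f : L2 S) :
    ∀ᵐ u, ∫ u', gramKernel K u u' * f u' = (ContinuousLinearMap.adjoint A ∘L A) f u := by
  have hA := h.apply_ae_eq f
  filter_upwards [h.adjoint.apply_ae_eq (A f), h.ae_memLp_fiber] with u hu hKu
  rw [comp_apply, hu]
  have hint : Integrable (fun p : S × T => (K p.1 p.2) * (f p.1 * K u p.2))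
      ((volume : Measure S).prod (volume : Measure T)) :=
    h.memLp.integrable_mul (memLp_two_mul_prod (Lp.memLp f) hKu)
  calc ∫ u', gramKernel K u u' * f u'
      = ∫ u', ∫ v, K u' v * (f u' * K u v) := by
        refine integral_congr_ae (ae_of_all _ fun u' => ?_)
        simp only [gramKernel]
        rw [← integral_mul_const]
        exact integral_congr_ae (ae_of_all _ fun v => by ring)
    _ = ∫ v, ∫ u', K u' v * (f u' * K u v) := integral_integral_swap hint
    _ = ∫ v, K u v * A f v := by
        refine integral_congr_ae ?_
        filter_upwards [hA] with v hv
        rw [hv, ← integral_const_mul]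
        exact integral_congr_ae (ae_of_all _ fun u' => by ring)

theorem isEigenfunction_iff (h : IsKernelOf K A) (s : ℝ) (f : L2 S) :
    IsEigenfunction (gramKernel K) s f ↔ (ContinuousLinearMap.adjoint A ∘L A) f = s • f := by
  have h1 := h.integral_gramKernel_ae_eq f
  have h2 := Lp.coeFn_smul s f
  rw [Lp.ext_iff]
  constructor
  · intro hf
    filter_upwards [h1, h2, hf] with u hu1 hu2 hu3
    rw [← hu1, hu2, hu3]
    rfl
  · intro hf
    filter_upwards [h1, h2, hf] with u hu1 hu2 hu3
    rw [hu1, hu3, hu2]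
    rfl

theorem kthEigenvalue_eq (h : IsKernelOf K A) (k : ℕ) :
    kthEigenvalue (gramKernel K) k = opEigenvalue (ContinuousLinearMap.adjoint A ∘L A) k := by
  have e : ∀ t, eigenSpan (gramKernel K) t = opEigenSpan (ContinuousLinearMap.adjoint A ∘L A) t := by
    intro t
    have : {f | ∃ s, t ≤ s ∧ IsEigenfunction (gramKernel K) s f}
        = {f | ∃ s, t ≤ s ∧ (ContinuousLinearMap.adjoint A ∘L A) f = s • f} :=
      Set.ext fun f => exists_congr fun s => and_congr_right fun _ => h.isEigenfunction_iff s f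
    rw [eigenSpan, this, opEigenSpan]
  refine congrArg sSup (Set.ext fun t => and_congr_right fun _ => ?_)
  rw [e]

theorem add {K' : S → T → ℝ} {A' : L2 S →L[ℝ] L2 T} (h : IsKernelOf K A) (h' : IsKernelOf K' A') :
    IsKernelOf (fun u v => K u v + K' u v) (A + A') := by
  refine ⟨h.memLp.add h'.memLp, fun f g => ?_⟩
  have hfg := memLp_two_mul_prod (Lp.memLp f) (Lp.memLp g)
  rw [add_apply, inner_add_right, h.inner_eq, h'.inner_eq, ← integral_add]
  · simp only [add_mul]
  · exact h.memLp.integrable_mul hfg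
  · exact h'.memLp.integrable_mul hfg

theorem sum {ι : Type*} (s : Finset ι) {K : ι → S → T → ℝ} {A : ι → L2 S →L[ℝ] L2 T}
    (h : ∀ i ∈ s, IsKernelOf (K i) (A i)) :
    IsKernelOf (fun u v => ∑ i ∈ s, K i u v) (∑ i ∈ s, A i) := by
  classical
  induction s using Finset.induction_on with
  | empty => simpa using zero
  | insert i s hi ih =>
    simp only [Finset.sum_insert hi]
    exact (h i (Finset.mem_insert_self _ _)).add
      (ih fun j hj => h j (Finset.mem_insert_of_mem hj))

end IsKernelOf

theorem isKernelOf_rankOne {a : S → ℝ} {b : T → ℝ} (ha : MemLp a 2 (volume : Measure S))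
    (hb : MemLp b 2 (volume : Measure T)) :
    IsKernelOf (fun u v => a u * b v) (rankOne ℝ (hb.toLp b) (ha.toLp a)) := by
  refine ⟨memLp_two_mul_prod ha hb, fun f g => ?_⟩
  rw [rankOne_apply, real_inner_smul_right, real_inner_comm (hb.toLp b) g, inner_toLp, inner_toLp,
    ← integral_prod_mul]
  exact integral_congr_ae (ae_of_all _ fun p => by ring)

theorem isKernelOf_sampleCovOp (Y : ℕ → RandomCurve Ω S) (X : ℕ → RandomCurve Ω T) (n : ℕ)
    (ω : Ω) : IsKernelOf (sampleCovKernel Y X n ω) (sampleCovOp Y X n ω) := by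
  have h1 : IsKernelOf (fun u v => ∑ i ∈ Finset.range n, Y i ω u * X i ω v)
      (∑ i ∈ Finset.range n, rankOne ℝ ((X i).toL2 ω) ((Y i).toL2 ω)) :=
    IsKernelOf.sum _ fun i _ => isKernelOf_rankOne ((Y i).memLp ω) ((X i).memLp ω)
  have h2 := isKernelOf_rankOne (memLp_sampleMean Y n ω) (memLp_sampleMean X n ω)
  rw [toLp_sampleMean, toLp_sampleMean] at h2
  have h3 := (h1.smul (n : ℝ)⁻¹).add (h2.smul (-1))
  rw [neg_one_smul, ← sub_eq_add_neg] at h3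
  convert! h3 using 1
  ext u v
  rw [sampleCovKernel_eq]
  ring

end Kernels

section CurveMoments

open scoped InnerProductSpace
open ContinuousLinearMap InnerProductSpace

theorem eLpNorm_two_sq {α E : Type*} [MeasurableSpace α] [NormedAddCommGroup E] (f : α → E)
    (μ : Measure α) : eLpNorm f 2 μ ^ 2 = ∫⁻ x, ‖f x‖ₑ ^ 2 ∂μ := by
  have := eLpNorm_nnreal_pow_eq_lintegral (f := f) (μ := μ) (p := 2) (by norm_num)
  simpa using this

theorem memLp_two_of_lintegral_lt_top {α E : Type*} [MeasurableSpace α] [NormedAddCommGroup E]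
    {f : α → E} {μ : Measure α} (hf : AEStronglyMeasurable f μ)
    (h : ∫⁻ x, ‖f x‖ₑ ^ 2 ∂μ < ∞) : MemLp f 2 μ := by
  refine ⟨hf, ?_⟩
  rw [← eLpNorm_two_sq] at h
  exact (ENNReal.pow_lt_top_iff.1 h).resolve_right two_ne_zero

theorem enorm_integral_sq_le {α : Type*} [MeasurableSpace α] {μ : Measure α}
    [IsProbabilityMeasure μ] {f : α → ℝ} (hf : AEStronglyMeasurable f μ) :
    ‖∫ x, f x ∂μ‖ₑ ^ 2 ≤ ∫⁻ x, ‖f x‖ₑ ^ 2 ∂μ := by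
  rw [← eLpNorm_two_sq]
  gcongr
  calc ‖∫ x, f x ∂μ‖ₑ ≤ ∫⁻ x, ‖f x‖ₑ ∂μ := enorm_integral_le_lintegral_enorm _
    _ = eLpNorm f 1 μ := (eLpNorm_one_eq_lintegral_enorm).symm
    _ ≤ eLpNorm f 2 μ := eLpNorm_le_eLpNorm_of_exponent_le one_le_two hf

variable {Ω S T : Type*} [MeasurableSpace Ω] [MeasureSpace S] [MeasureSpace T]

theorem enorm_toL2_sq (Y : RandomCurve Ω S) (ω : Ω) :
    ‖Y.toL2 ω‖ₑ ^ 2 = ∫⁻ u, ‖Y ω u‖ₑ ^ 2 := by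
  rw [RandomCurve.toL2, Lp.enorm_toLp, eLpNorm_two_sq]

theorem inner_toL2 (Y : RandomCurve Ω S) (ω : Ω) (f : L2 S) :
    ⟪Y.toL2 ω, f⟫_ℝ = ∫ u, Y ω u * f u := inner_toLp (Y.memLp ω) f

theorem measurable_inner_toL2 [SFinite (volume : Measure S)] (Y : RandomCurve Ω S) (f : L2 S) :
    Measurable fun ω => ⟪Y.toL2 ω, f⟫_ℝ := by
  simp only [inner_toL2]
  refine (StronglyMeasurable.integral_prod_right (f := fun ω u => Y ω u * f u) ?_).measurable
  exact (Y.measurable_uncurry.mul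
    ((Lp.stronglyMeasurable f).measurable.comp measurable_snd)).stronglyMeasurable

variable {μ : Measure Ω}

theorem memLp_uncurry [SFinite μ] [SFinite (volume : Measure S)] {Y : RandomCurve Ω S}
    (h : ∫⁻ ω, ‖Y.toL2 ω‖ₑ ^ 2 ∂μ < ∞) :
    MemLp (Function.uncurry Y.toFun) 2 (μ.prod volume) := by
  refine memLp_two_of_lintegral_lt_top Y.measurable_uncurry.aestronglyMeasurable ?_
  rw [lintegral_prod _ (Y.measurable_uncurry.enorm.pow_const 2).aemeasurable]
  simpa only [enorm_toL2_sq, Function.uncurry] using h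

theorem integral_inner_toL2_eq_zero [IsProbabilityMeasure μ] [IsFiniteMeasure (volume : Measure S)]
    {Y : RandomCurve Ω S} (h : ∫⁻ ω, ‖Y.toL2 ω‖ₑ ^ 2 ∂μ < ∞) (hmean : ∀ u, ∫ ω, Y ω u ∂μ = 0)
    (f : L2 S) : ∫ ω, ⟪Y.toL2 ω, f⟫_ℝ ∂μ = 0 := by
  simp only [inner_toL2]
  rw [integral_integral_swap]
  · simp only [integral_mul_const, hmean, zero_mul, integral_zero]
  · exact (memLp_uncurry h).integrable_mul ((Lp.memLp f).comp_snd μ)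

theorem lintegral_prod_sq_lt_top {Y : RandomCurve Ω S} {X : RandomCurve Ω T}
    (h : ∫⁻ ω, ((∫⁻ u, ‖Y ω u‖ₑ ^ 2) + ∫⁻ v, ‖X ω v‖ₑ ^ 2) ^ 2 ∂μ < ∞) :
    ∫⁻ ω, ‖Y.toL2 ω‖ₑ ^ 2 * ‖X.toL2 ω‖ₑ ^ 2 ∂μ < ∞ := by
  refine (lintegral_mono fun ω => ?_).trans_lt h
  rw [enorm_toL2_sq, enorm_toL2_sq, pow_two (_ + _)]
  exact mul_le_mul' le_self_add le_add_self

theorem lintegral_sq_lt_top_left [IsProbabilityMeasure μ] {Y : RandomCurve Ω S}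
    {X : RandomCurve Ω T}
    (h : ∫⁻ ω, ((∫⁻ u, ‖Y ω u‖ₑ ^ 2) + ∫⁻ v, ‖X ω v‖ₑ ^ 2) ^ 2 ∂μ < ∞) :
    ∫⁻ ω, ‖Y.toL2 ω‖ₑ ^ 2 ∂μ < ∞ := by
  have hle : ∀ a : ℝ≥0∞, a ≤ 1 + a ^ 2 := by
    intro a
    rcases le_total a 1 with ha | ha
    · exact ha.trans le_self_add
    · exact (le_self_pow₀ ha two_ne_zero).trans le_add_self
  calc ∫⁻ ω, ‖Y.toL2 ω‖ₑ ^ 2 ∂μ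
      ≤ ∫⁻ ω, (1 + ((∫⁻ u, ‖Y ω u‖ₑ ^ 2) + ∫⁻ v, ‖X ω v‖ₑ ^ 2) ^ 2) ∂μ := by
        refine lintegral_mono fun ω => ?_
        rw [enorm_toL2_sq]
        exact le_self_add.trans (hle _)
    _ = 1 + ∫⁻ ω, ((∫⁻ u, ‖Y ω u‖ₑ ^ 2) + ∫⁻ v, ‖X ω v‖ₑ ^ 2) ^ 2 ∂μ := by
        rw [lintegral_add_left measurable_const]
        simp
    _ < ∞ := ENNReal.add_lt_top.2 ⟨ENNReal.one_lt_top, h⟩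

theorem lintegral_sq_lt_top_right [IsProbabilityMeasure μ] {Y : RandomCurve Ω S}
    {X : RandomCurve Ω T}
    (h : ∫⁻ ω, ((∫⁻ u, ‖Y ω u‖ₑ ^ 2) + ∫⁻ v, ‖X ω v‖ₑ ^ 2) ^ 2 ∂μ < ∞) :
    ∫⁻ ω, ‖X.toL2 ω‖ₑ ^ 2 ∂μ < ∞ := by
  refine lintegral_sq_lt_top_left (Y := X) (X := Y) ?_
  simpa only [add_comm] using h

/-- The operator with kernel `cov(Y(u), X(v))`, as an expectation of rank one operators. -/
noncomputable def covOp (μ : Measure Ω) (Y : RandomCurve Ω S) (X : RandomCurve Ω T) :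
    L2 S →L[ℝ] L2 T :=
  ∫ ω, rankOne ℝ (X.toL2 ω) (Y.toL2 ω) ∂μ

theorem aestronglyMeasurable_rankOne {H H' : Type*} [NormedAddCommGroup H] [InnerProductSpace ℝ H]
    [NormedAddCommGroup H'] [InnerProductSpace ℝ H'] {x : Ω → H'} {y : Ω → H}
    (hx : AEStronglyMeasurable x μ) (hy : AEStronglyMeasurable y μ) :
    AEStronglyMeasurable (fun ω => rankOne ℝ (x ω) (y ω)) μ := by
  have hc : Continuous fun p : H' × H => rankOne ℝ p.1 p.2 :=
    ((rankOne ℝ).continuous.comp continuous_fst).clm_apply continuous_snd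
  exact Continuous.comp_aestronglyMeasurable (g := fun p : H' × H => rankOne ℝ p.1 p.2)
    (f := fun ω => (x ω, y ω)) hc (hx.prodMk hy)

section

variable {Y : RandomCurve Ω S} {X : RandomCurve Ω T} (hY : AEStronglyMeasurable Y.toL2 μ)
  (hX : AEStronglyMeasurable X.toL2 μ)
  (h : ∫⁻ ω, ‖Y.toL2 ω‖ₑ ^ 2 * ‖X.toL2 ω‖ₑ ^ 2 ∂μ < ∞)

include hY hX h in
theorem integrable_rankOne [IsProbabilityMeasure μ] :
    Integrable (fun ω => rankOne ℝ (X.toL2 ω) (Y.toL2 ω)) μ := by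
  have hm := aestronglyMeasurable_rankOne hX hY
  refine (memLp_two_of_lintegral_lt_top hm ?_).integrable one_le_two
  refine lt_of_eq_of_lt (lintegral_congr fun ω => ?_) h
  rw [enorm_rankOne, mul_pow, mul_comm]

include hY hX h in
theorem inner_covOp [IsProbabilityMeasure μ] (f : L2 S) (g : L2 T) :
    ⟪g, covOp μ Y X f⟫_ℝ = ∫ ω, ⟪Y.toL2 ω, f⟫_ℝ * ⟪X.toL2 ω, g⟫_ℝ ∂μ := by
  have hi := integrable_rankOne hY hX h
  rw [covOp, ContinuousLinearMap.integral_apply hi, ← integral_inner (hi.apply_continuousLinearMap f)]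
  simp only [rankOne_apply, real_inner_smul_right, real_inner_comm]

include hY hX h in
theorem isCompactOperator_covOp [IsProbabilityMeasure μ] : IsCompactOperator (covOp μ Y X) := by
  let C : Submodule ℝ (L2 S →L[ℝ] L2 T) := compactOperator (RingHom.id ℝ) (L2 S) (L2 T)
  have hC : IsClosed (C : Set (L2 S →L[ℝ] L2 T)) := isClosed_setOfPred_isCompactOperator
  have : covOp μ Y X ∈ (C : Set (L2 S →L[ℝ] L2 T)) :=
    C.convex.integral_mem hC (ae_of_all _ fun ω => isCompactOperator_rankOne _ _)
      (integrable_rankOne hY hX h)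
  exact this

include hY hX h in
theorem isKernelOf_covOp [IsProbabilityMeasure μ] [IsFiniteMeasure (volume : Measure S)]
    [IsFiniteMeasure (volume : Measure T)]
    (hYmean : ∀ u, ∫ ω, Y ω u ∂μ = 0) (hXmean : ∀ v, ∫ ω, X ω v ∂μ = 0) :
    IsKernelOf (covKernel μ Y X) (covOp μ Y X) := by
  have hK : ∀ u v, covKernel μ Y X u v = ∫ ω, Y ω u * X ω v ∂μ := by
    intro u v
    simp only [covKernel, covariance, hYmean, hXmean, sub_zero]
  have hF : Measurable fun q : Ω × (S × T) => Y q.1 q.2.1 * X q.1 q.2.2 :=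
    (Y.measurable_uncurry.comp (measurable_fst.prodMk (measurable_fst.comp measurable_snd))).mul
      (X.measurable_uncurry.comp (measurable_fst.prodMk (measurable_snd.comp measurable_snd)))
  have hFω : ∀ ω, ∫⁻ p : S × T, ‖Y ω p.1 * X ω p.2‖ₑ ^ 2 ∂(volume : Measure S).prod volume
      = ‖Y.toL2 ω‖ₑ ^ 2 * ‖X.toL2 ω‖ₑ ^ 2 := by
    intro ω
    rw [enorm_toL2_sq, enorm_toL2_sq]
    simp only [enorm_mul, mul_pow]
    exact lintegral_prod_mul ((Y.memLp ω).1.enorm.pow_const 2) ((X.memLp ω).1.enorm.pow_const 2)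
  have hF2 : MemLp (fun q : Ω × (S × T) => Y q.1 q.2.1 * X q.1 q.2.2) 2
      (μ.prod ((volume : Measure S).prod (volume : Measure T))) := by
    refine memLp_two_of_lintegral_lt_top hF.aestronglyMeasurable ?_
    rw [lintegral_prod _ (hF.enorm.pow_const 2).aemeasurable]
    simpa only [hFω] using h
  refine ⟨memLp_two_of_lintegral_lt_top ?_ ?_, fun f g => ?_⟩
  · have : StronglyMeasurable fun p : S × T => ∫ ω, Y ω p.1 * X ω p.2 ∂μ :=
      hF.stronglyMeasurable.integral_prod_left'
    refine this.aestronglyMeasurable.congr (ae_of_all _ fun p => ?_)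
    exact (hK _ _).symm
  · calc ∫⁻ p : S × T, ‖covKernel μ Y X p.1 p.2‖ₑ ^ 2 ∂(volume : Measure S).prod volume
        ≤ ∫⁻ p : S × T, ∫⁻ ω, ‖Y ω p.1 * X ω p.2‖ₑ ^ 2 ∂μ ∂(volume : Measure S).prod volume := by
          refine lintegral_mono fun p => ?_
          rw [hK]
          exact enorm_integral_sq_le (hF.comp measurable_prodMk_right).aestronglyMeasurable
      _ = ∫⁻ ω, ∫⁻ p : S × T, ‖Y ω p.1 * X ω p.2‖ₑ ^ 2 ∂(volume : Measure S).prod volume ∂μ :=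
          (lintegral_lintegral_swap (hF.enorm.pow_const 2).aemeasurable).symm
      _ < ∞ := by simpa only [hFω] using h
  · have hfg := memLp_two_mul_prod (Lp.memLp f) (Lp.memLp g)
    have hint : Integrable (fun q : Ω × (S × T) =>
        (Y q.1 q.2.1 * X q.1 q.2.2) * (f q.2.1 * g q.2.2))
        (μ.prod ((volume : Measure S).prod (volume : Measure T))) :=
      hF2.integrable_mul (hfg.comp_snd μ)
    rw [inner_covOp hY hX h]
    calc ∫ ω, ⟪Y.toL2 ω, f⟫_ℝ * ⟪X.toL2 ω, g⟫_ℝ ∂μ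
        = ∫ ω, ∫ p : S × T, (Y ω p.1 * X ω p.2) * (f p.1 * g p.2)
            ∂(volume : Measure S).prod volume ∂μ := by
          refine integral_congr_ae (ae_of_all _ fun ω => ?_)
          simp only [inner_toL2]
          rw [← integral_prod_mul]
          exact integral_congr_ae (ae_of_all _ fun p => by ring)
      _ = ∫ p : S × T, ∫ ω, (Y ω p.1 * X ω p.2) * (f p.1 * g p.2) ∂μ
            ∂(volume : Measure S).prod volume := integral_integral_swap hint
      _ = _ := by
          refine integral_congr_ae (ae_of_all _ fun p => ?_)
          simp only [hK]
          rw [integral_mul_const]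

end

end CurveMoments

section Mixing

variable {Ω : Type*} [MeasurableSpace Ω] {μ : Measure Ω}

/-- A two-sided bilinear inequality between joint and product probabilities extends from events
to nonnegative random variables. -/
theorem lintegral_mul_le_of_forall_measure_inter_le {U V : Ω → ℝ≥0∞} (hU : Measurable U)
    (hV : Measurable V) {a b c d : ℝ≥0∞}
    (h : ∀ s t, MeasurableSet s → MeasurableSet t →
      a * (μ (U ⁻¹' s) * μ (V ⁻¹' t)) + b * μ (U ⁻¹' s ∩ V ⁻¹' t) ≤
        c * (μ (U ⁻¹' s) * μ (V ⁻¹' t)) + d * μ (U ⁻¹' s ∩ V ⁻¹' t)) :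
    a * ((∫⁻ ω, U ω ∂μ) * ∫⁻ ω, V ω ∂μ) + b * ∫⁻ ω, U ω * V ω ∂μ ≤
      c * ((∫⁻ ω, U ω ∂μ) * ∫⁻ ω, V ω ∂μ) + d * ∫⁻ ω, U ω * V ω ∂μ := by
  have hmap : ∀ {W : Ω → ℝ≥0∞} (ν : Measure Ω), Measurable W →
      ∫⁻ x, x ∂ν.map W = ∫⁻ ω, W ω ∂ν := fun ν hW => lintegral_map measurable_id hW
  have step : ∀ t, MeasurableSet t →
      a * ((∫⁻ ω, U ω ∂μ) * μ (V ⁻¹' t)) + b * ∫⁻ ω in V ⁻¹' t, U ω ∂μ ≤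
        c * ((∫⁻ ω, U ω ∂μ) * μ (V ⁻¹' t)) + d * ∫⁻ ω in V ⁻¹' t, U ω ∂μ := by
    intro t ht
    have hle : (a * μ (V ⁻¹' t)) • μ.map U + b • (μ.restrict (V ⁻¹' t)).map U ≤
        (c * μ (V ⁻¹' t)) • μ.map U + d • (μ.restrict (V ⁻¹' t)).map U := by
      refine Measure.le_iff.2 fun s hs => ?_
      simp only [Measure.add_apply, Measure.smul_apply, smul_eq_mul, Measure.map_apply hU hs,
        Measure.restrict_apply (hU hs)]
      have := h s t hs ht
      calc a * μ (V ⁻¹' t) * μ (U ⁻¹' s) + b * μ (U ⁻¹' s ∩ V ⁻¹' t)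
          = a * (μ (U ⁻¹' s) * μ (V ⁻¹' t)) + b * μ (U ⁻¹' s ∩ V ⁻¹' t) := by ring
        _ ≤ _ := this
        _ = _ := by ring
    have := lintegral_mono' hle (le_refl (id : ℝ≥0∞ → ℝ≥0∞))
    simp only [lintegral_add_measure, lintegral_smul_measure, smul_eq_mul, id, hmap _ hU] at this
    calc a * ((∫⁻ ω, U ω ∂μ) * μ (V ⁻¹' t)) + b * ∫⁻ ω in V ⁻¹' t, U ω ∂μ
        = a * μ (V ⁻¹' t) * (∫⁻ ω, U ω ∂μ) + b * ∫⁻ ω in V ⁻¹' t, U ω ∂μ := by ring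
      _ ≤ c * μ (V ⁻¹' t) * (∫⁻ ω, U ω ∂μ) + d * ∫⁻ ω in V ⁻¹' t, U ω ∂μ := this
      _ = _ := by ring
  have hle : (a * ∫⁻ ω, U ω ∂μ) • μ.map V + b • (μ.withDensity U).map V ≤
      (c * ∫⁻ ω, U ω ∂μ) • μ.map V + d • (μ.withDensity U).map V := by
    refine Measure.le_iff.2 fun t ht => ?_
    simp only [Measure.add_apply, Measure.smul_apply, smul_eq_mul, Measure.map_apply hV ht,
      withDensity_apply _ (hV ht), mul_assoc]
    exact step t ht
  have := lintegral_mono' hle (le_refl (id : ℝ≥0∞ → ℝ≥0∞))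
  simpa only [lintegral_add_measure, lintegral_smul_measure, hmap _ hV,
    smul_eq_mul, id, lintegral_withDensity_eq_lintegral_mul _ hU hV, Pi.mul_apply, mul_assoc]
    using this

variable {E : Type*} [MeasurableSpace E] {Z : ℕ → Ω → E}

theorem psiCoeff_summable
    (hsum : ∑' k : ℕ, (k : ℝ≥0∞) * psiCoeff Z μ k ^ (1 / 2 : ℝ) < ∞) :
    (∀ k, 1 ≤ k → psiCoeff Z μ k ≠ ∞) ∧
      Summable fun k : ℕ => if k = 0 then 1 else (psiCoeff Z μ k).toReal := by
  set s := ∑' k : ℕ, (k : ℝ≥0∞) * psiCoeff Z μ k ^ (1 / 2 : ℝ) with hs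
  have hhalf : ∀ k : ℕ, 1 ≤ k →
      psiCoeff Z μ k ^ (1 / 2 : ℝ) ≤ (k : ℝ≥0∞) * psiCoeff Z μ k ^ (1 / 2 : ℝ) := fun k hk =>
    le_mul_of_one_le_left zero_le (by exact_mod_cast hk)
  have hterm : ∀ k : ℕ, (k : ℝ≥0∞) * psiCoeff Z μ k ^ (1 / 2 : ℝ) ≤ s := fun k => ENNReal.le_tsum k
  have hle : ∀ k : ℕ, 1 ≤ k → psiCoeff Z μ k ≤ s * ((k : ℝ≥0∞) * psiCoeff Z μ k ^ (1 / 2 : ℝ)) := by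
    intro k hk
    calc psiCoeff Z μ k = psiCoeff Z μ k ^ (1 / 2 : ℝ) * psiCoeff Z μ k ^ (1 / 2 : ℝ) := by
          rw [← ENNReal.rpow_add_of_nonneg _ _ (by norm_num) (by norm_num)]
          norm_num
      _ ≤ _ := mul_le_mul' ((hhalf k hk).trans (hterm k)) (hhalf k hk)
  have hfin : ∀ k : ℕ, 1 ≤ k → psiCoeff Z μ k ≠ ∞ := fun k hk =>
    ((hle k hk).trans_lt (ENNReal.mul_lt_top hsum ((hterm k).trans_lt hsum))).ne
  refine ⟨hfin, ?_⟩
  have htot : ∑' k : ℕ, (if k = 0 then (1 : ℝ≥0∞) else psiCoeff Z μ k) ≠ ∞ := by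
    refine ne_top_of_le_ne_top (b := 1 + s * s) (ENNReal.add_ne_top.2
      ⟨ENNReal.one_ne_top, (ENNReal.mul_lt_top hsum hsum).ne⟩) ?_
    calc ∑' k : ℕ, (if k = 0 then (1 : ℝ≥0∞) else psiCoeff Z μ k)
        ≤ ∑' k : ℕ, ((if k = 0 then (1 : ℝ≥0∞) else 0) +
            s * ((k : ℝ≥0∞) * psiCoeff Z μ k ^ (1 / 2 : ℝ))) := by
          refine ENNReal.tsum_le_tsum fun k => ?_
          rcases eq_or_ne k 0 with rfl | hk
          · simp
          · simpa [hk] using hle k (Nat.one_le_iff_ne_zero.2 hk)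
      _ = 1 + s * s := by
          rw [ENNReal.tsum_add, ENNReal.tsum_mul_left, tsum_ite_eq, ← hs]
  refine (ENNReal.summable_toReal htot).congr fun k => ?_
  split_ifs <;> simp

theorem sum_range_dist_le {ρ : ℕ → ℝ} (hρ : Summable ρ) (h0 : ∀ k, 0 ≤ ρ k) (n i : ℕ) :
    ∑ j ∈ Finset.range n, ρ (i - j + (j - i)) ≤ 2 * ∑' k, ρ k := by
  have hinj : ∀ (s : Finset ℕ) (e : ℕ → ℕ), Set.InjOn e s → ∑ j ∈ s, ρ (e j) ≤ ∑' k, ρ k := by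
    intro s e he
    rw [← Finset.sum_image (f := ρ) he]
    exact hρ.sum_le_tsum _ fun k _ => h0 k
  rw [← Finset.sum_filter_add_sum_filter_not _ (fun j => j ≤ i), two_mul]
  refine add_le_add (hinj _ _ ?_) (hinj _ _ ?_)
  · intro j hj j' hj' hjj
    simp only [Finset.coe_filter, Set.mem_ofPred_eq] at hj hj' hjj
    omega
  · intro j hj j' hj' hjj
    simp only [Finset.coe_filter, Set.mem_ofPred_eq] at hj hj' hjj
    omega

variable [IsProbabilityMeasure μ]

theorem abs_integral_mul_sub_le_of_nonneg {U V : Ω → ℝ} (hU : Measurable U) (hV : Measurable V)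
    (hU0 : ∀ ω, 0 ≤ U ω) (hV0 : ∀ ω, 0 ≤ V ω) (hU2 : MemLp U 2 μ) (hV2 : MemLp V 2 μ)
    {ψ : ℝ} (hψ : 0 ≤ ψ)
    (h : ∀ s t, MeasurableSet s → MeasurableSet t →
      |μ.real (U ⁻¹' s ∩ V ⁻¹' t) - μ.real (U ⁻¹' s) * μ.real (V ⁻¹' t)| ≤
        ψ * (μ.real (U ⁻¹' s) * μ.real (V ⁻¹' t))) :
    |∫ ω, U ω * V ω ∂μ - (∫ ω, U ω ∂μ) * ∫ ω, V ω ∂μ| ≤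
      ψ * ((∫ ω, U ω ∂μ) * ∫ ω, V ω ∂μ) := by
  have hUi := hU2.integrable one_le_two
  have hVi := hV2.integrable one_le_two
  have hUVi : Integrable (fun ω => U ω * V ω) μ := hU2.integrable_mul hV2
  have eU : ∫⁻ ω, ENNReal.ofReal (U ω) ∂μ = ENNReal.ofReal (∫ ω, U ω ∂μ) :=
    (ofReal_integral_eq_lintegral_ofReal hUi (ae_of_all _ hU0)).symm
  have eV : ∫⁻ ω, ENNReal.ofReal (V ω) ∂μ = ENNReal.ofReal (∫ ω, V ω ∂μ) :=
    (ofReal_integral_eq_lintegral_ofReal hVi (ae_of_all _ hV0)).symm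
  have eUV : ∫⁻ ω, ENNReal.ofReal (U ω) * ENNReal.ofReal (V ω) ∂μ
      = ENNReal.ofReal (∫ ω, U ω * V ω ∂μ) := by
    rw [ofReal_integral_eq_lintegral_ofReal hUVi
      (ae_of_all _ fun ω => mul_nonneg (hU0 ω) (hV0 ω))]
    exact lintegral_congr fun ω => (ENNReal.ofReal_mul (hU0 ω)).symm
  have hUI : 0 ≤ ∫ ω, U ω ∂μ := integral_nonneg hU0
  have hVI : 0 ≤ ∫ ω, V ω ∂μ := integral_nonneg hV0
  have hUVI : 0 ≤ ∫ ω, U ω * V ω ∂μ := integral_nonneg fun ω => mul_nonneg (hU0 ω) (hV0 ω)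
  have hr : ∀ s t : Set ℝ≥0∞, MeasurableSet s → MeasurableSet t →
      |μ.real ((fun ω => ENNReal.ofReal (U ω)) ⁻¹' s ∩ (fun ω => ENNReal.ofReal (V ω)) ⁻¹' t)
        - μ.real ((fun ω => ENNReal.ofReal (U ω)) ⁻¹' s)
          * μ.real ((fun ω => ENNReal.ofReal (V ω)) ⁻¹' t)| ≤
        ψ * (μ.real ((fun ω => ENNReal.ofReal (U ω)) ⁻¹' s)
          * μ.real ((fun ω => ENNReal.ofReal (V ω)) ⁻¹' t)) := fun s t hs ht =>
    h (ENNReal.ofReal ⁻¹' s) (ENNReal.ofReal ⁻¹' t) (ENNReal.measurable_ofReal hs) (ENNReal.measurable_ofReal ht)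
  have conv : ∀ s : Set Ω, μ s = ENNReal.ofReal (μ.real s) := fun s =>
    (ofReal_measureReal (measure_ne_top _ _)).symm
  have upper : (0 : ℝ≥0∞) * _ + 1 * _ ≤ ENNReal.ofReal (1 + ψ) * _ + 0 * _ :=
    lintegral_mul_le_of_forall_measure_inter_le (μ := μ)
      (U := fun ω => ENNReal.ofReal (U ω)) (V := fun ω => ENNReal.ofReal (V ω))
      hU.ennreal_ofReal hV.ennreal_ofReal fun s t hs ht => by
        have := (abs_le.1 (hr s t hs ht)).2
        rw [zero_mul, zero_add, one_mul, zero_mul, add_zero, conv, conv (_ ⁻¹' s), conv (_ ⁻¹' t),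
          ← ENNReal.ofReal_mul measureReal_nonneg, ← ENNReal.ofReal_mul (add_nonneg zero_le_one hψ)]
        refine ENNReal.ofReal_le_ofReal ?_
        linarith
  have lower : (1 : ℝ≥0∞) * _ + 0 * _ ≤ ENNReal.ofReal ψ * _ + 1 * _ :=
    lintegral_mul_le_of_forall_measure_inter_le (μ := μ)
      (U := fun ω => ENNReal.ofReal (U ω)) (V := fun ω => ENNReal.ofReal (V ω))
      hU.ennreal_ofReal hV.ennreal_ofReal fun s t hs ht => by
        have := (abs_le.1 (hr s t hs ht)).1
        rw [zero_mul, one_mul, one_mul, add_zero, conv (_ ∩ _), conv (_ ⁻¹' s), conv (_ ⁻¹' t),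
          ← ENNReal.ofReal_mul measureReal_nonneg, ← ENNReal.ofReal_mul hψ,
          ← ENNReal.ofReal_add (mul_nonneg hψ (mul_nonneg measureReal_nonneg measureReal_nonneg))
            measureReal_nonneg]
        refine ENNReal.ofReal_le_ofReal ?_
        linarith
  simp only [zero_mul, zero_add, one_mul, add_zero, eU, eV, eUV] at upper lower
  rw [← ENNReal.ofReal_mul hUI, ← ENNReal.ofReal_mul (by positivity),
    ENNReal.ofReal_le_ofReal_iff (by positivity)] at upper
  rw [← ENNReal.ofReal_mul hUI, ← ENNReal.ofReal_mul (by positivity),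
    ← ENNReal.ofReal_add (by positivity) (by positivity),
    ENNReal.ofReal_le_ofReal_iff (by positivity)] at lower
  rw [abs_le]
  constructor <;> linarith

theorem abs_integral_mul_sub_le {U V : Ω → ℝ} (hU : Measurable U) (hV : Measurable V)
    (hU2 : MemLp U 2 μ) (hV2 : MemLp V 2 μ) {ψ : ℝ} (hψ : 0 ≤ ψ)
    (h : ∀ s t, MeasurableSet s → MeasurableSet t →
      |μ.real (U ⁻¹' s ∩ V ⁻¹' t) - μ.real (U ⁻¹' s) * μ.real (V ⁻¹' t)| ≤
        ψ * (μ.real (U ⁻¹' s) * μ.real (V ⁻¹' t))) :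
    |∫ ω, U ω * V ω ∂μ - (∫ ω, U ω ∂μ) * ∫ ω, V ω ∂μ| ≤
      ψ * ((∫ ω, |U ω| ∂μ) * ∫ ω, |V ω| ∂μ) := by
  have hpos : Measurable fun x : ℝ => max x 0 := measurable_id.max measurable_const
  have hneg : Measurable fun x : ℝ => max (-x) 0 := measurable_neg.max measurable_const
  have key : ∀ f g : ℝ → ℝ, Measurable f → Measurable g → (∀ x, 0 ≤ f x) → (∀ x, 0 ≤ g x) →
      MemLp (fun ω => f (U ω)) 2 μ → MemLp (fun ω => g (V ω)) 2 μ →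
      |∫ ω, f (U ω) * g (V ω) ∂μ - (∫ ω, f (U ω) ∂μ) * ∫ ω, g (V ω) ∂μ| ≤
      ψ * ((∫ ω, f (U ω) ∂μ) * ∫ ω, g (V ω) ∂μ) := fun f g hf hg hf0 hg0 hfU hgV =>
    abs_integral_mul_sub_le_of_nonneg (hf.comp hU) (hg.comp hV) (fun ω => hf0 _) (fun ω => hg0 _)
      hfU hgV hψ fun s t hs ht => h (f ⁻¹' s) (g ⁻¹' t) (hf hs) (hg ht)
  have mpos : ∀ {W : Ω → ℝ}, MemLp W 2 μ → MemLp (fun ω => max (W ω) 0) 2 μ :=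
    fun hW => hW.pos_part
  have mneg : ∀ {W : Ω → ℝ}, MemLp W 2 μ → MemLp (fun ω => max (-W ω) 0) 2 μ :=
    fun hW => hW.neg_part
  have c1 := key _ _ hpos hpos (fun _ => le_max_right _ _) (fun _ => le_max_right _ _)
    (mpos hU2) (mpos hV2)
  have c2 := key _ _ hpos hneg (fun _ => le_max_right _ _) (fun _ => le_max_right _ _)
    (mpos hU2) (mneg hV2)
  have c3 := key _ _ hneg hpos (fun _ => le_max_right _ _) (fun _ => le_max_right _ _)
    (mneg hU2) (mpos hV2)
  have c4 := key _ _ hneg hneg (fun _ => le_max_right _ _) (fun _ => le_max_right _ _)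
    (mneg hU2) (mneg hV2)
  have hsub : ∀ x : ℝ, x = max x 0 - max (-x) 0 := fun x => by
    rcases le_total 0 x with hx | hx
    · rw [max_eq_left hx, max_eq_right (by linarith)]; ring
    · rw [max_eq_right hx, max_eq_left (by linarith)]; ring
  have habs : ∀ x : ℝ, |x| = max x 0 + max (-x) 0 := fun x => by
    rcases le_total 0 x with hx | hx
    · rw [max_eq_left hx, max_eq_right (by linarith), abs_of_nonneg hx]; ring
    · rw [max_eq_right hx, max_eq_left (by linarith), abs_of_nonpos hx]; ring
  have iW : ∀ {W : Ω → ℝ}, MemLp W 2 μ →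
      ∫ ω, W ω ∂μ = ∫ ω, max (W ω) 0 ∂μ - ∫ ω, max (-W ω) 0 ∂μ := fun {W} hW => by
    rw [← integral_sub ((mpos hW).integrable one_le_two) ((mneg hW).integrable one_le_two)]
    exact integral_congr_ae (ae_of_all _ fun ω => hsub _)
  have iA : ∀ {W : Ω → ℝ}, MemLp W 2 μ →
      ∫ ω, |W ω| ∂μ = ∫ ω, max (W ω) 0 ∂μ + ∫ ω, max (-W ω) 0 ∂μ := fun {W} hW => by
    rw [← integral_add ((mpos hW).integrable one_le_two) ((mneg hW).integrable one_le_two)]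
    exact integral_congr_ae (ae_of_all _ fun ω => habs _)
  have iUV : ∫ ω, U ω * V ω ∂μ =
      (∫ ω, max (U ω) 0 * max (V ω) 0 ∂μ - ∫ ω, max (U ω) 0 * max (-V ω) 0 ∂μ)
      - (∫ ω, max (-U ω) 0 * max (V ω) 0 ∂μ - ∫ ω, max (-U ω) 0 * max (-V ω) 0 ∂μ) := by
    have i1 : Integrable (fun ω => max (U ω) 0 * max (V ω) 0) μ :=
      (mpos hU2).integrable_mul (mpos hV2)
    have i2 : Integrable (fun ω => max (U ω) 0 * max (-V ω) 0) μ :=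
      (mpos hU2).integrable_mul (mneg hV2)
    have i3 : Integrable (fun ω => max (-U ω) 0 * max (V ω) 0) μ :=
      (mneg hU2).integrable_mul (mpos hV2)
    have i4 : Integrable (fun ω => max (-U ω) 0 * max (-V ω) 0) μ :=
      (mneg hU2).integrable_mul (mneg hV2)
    have j1 : Integrable (fun ω => max (U ω) 0 * max (V ω) 0 - max (U ω) 0 * max (-V ω) 0) μ :=
      i1.sub i2
    have j2 : Integrable (fun ω => max (-U ω) 0 * max (V ω) 0 - max (-U ω) 0 * max (-V ω) 0) μ :=
      i3.sub i4
    rw [← integral_sub i1 i2, ← integral_sub i3 i4, ← integral_sub j1 j2]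
    refine integral_congr_ae (ae_of_all _ fun ω => ?_)
    show U ω * V ω = _
    conv_lhs => rw [hsub (U ω), hsub (V ω)]
    ring
  rw [iUV, iW hU2, iW hV2, iA hU2, iA hV2]
  rw [abs_le] at c1 c2 c3 c4 ⊢
  obtain ⟨a1, b1⟩ := c1
  obtain ⟨a2, b2⟩ := c2
  obtain ⟨a3, b3⟩ := c3
  obtain ⟨a4, b4⟩ := c4
  constructor <;> linarith

theorem abs_measureReal_inter_sub_le {k : ℕ} (hk : psiCoeff Z μ k ≠ ∞) {m : ℕ} {A B : Set Ω}
    (hA : MeasurableSet[pastSigma Z m] A) (hB : MeasurableSet[futureSigma Z (m + k)] B)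
    (hA' : MeasurableSet A) :
    |μ.real (A ∩ B) - μ.real A * μ.real B| ≤
      (psiCoeff Z μ k).toReal * (μ.real A * μ.real B) := by
  rcases eq_zero_or_pos (μ A) with h0 | hA0
  · have h1 : μ.real A = 0 := by simp [measureReal_def, h0]
    have h2 : μ.real (A ∩ B) = 0 := by
      simp [measureReal_def, measure_mono_null Set.inter_subset_left h0]
    simp [h1, h2]
  rcases eq_zero_or_pos (μ B) with h0 | hB0
  · have h1 : μ.real B = 0 := by simp [measureReal_def, h0]
    have h2 : μ.real (A ∩ B) = 0 := by
      simp [measureReal_def, measure_mono_null Set.inter_subset_right h0]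
    simp [h1, h2]
  have hle : ENNReal.ofReal |1 - (μ[|A]).real B / μ.real B| ≤ psiCoeff Z μ k :=
    le_iSup_of_le m <| le_iSup_of_le A <| le_iSup_of_le B <| le_iSup_of_le hA <|
      le_iSup_of_le hB <| le_iSup_of_le hA0 <| le_iSup_of_le hB0 le_rfl
  have hle' := (ENNReal.ofReal_le_iff_le_toReal hk).1 hle
  have hAr : 0 < μ.real A := ENNReal.toReal_pos hA0.ne' (measure_ne_top _ _)
  have hBr : 0 < μ.real B := ENNReal.toReal_pos hB0.ne' (measure_ne_top _ _)
  have hcond : (μ[|A]).real B = (μ.real A)⁻¹ * μ.real (A ∩ B) := by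
    rw [measureReal_def, cond_apply hA', ENNReal.toReal_mul, ENNReal.toReal_inv]
    rfl
  have e : μ.real (A ∩ B) - μ.real A * μ.real B =
      -((1 - (μ[|A]).real B / μ.real B) * (μ.real A * μ.real B)) := by
    rw [hcond]
    field_simp
    ring
  rw [e, abs_neg, abs_mul, abs_of_pos (mul_pos hAr hBr)]
  exact mul_le_mul_of_nonneg_right hle' (mul_pos hAr hBr).le

theorem abs_covariance_le_psiCoeff {φ : E → ℝ} (hφ : Measurable φ)
    (hm : ∀ i, Measurable fun ω => φ (Z i ω)) (h2 : ∀ i, MemLp (fun ω => φ (Z i ω)) 2 μ)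
    {m k : ℕ} (hk : psiCoeff Z μ k ≠ ∞) :
    |cov[fun ω => φ (Z m ω), fun ω => φ (Z (m + k) ω); μ]| ≤
      (psiCoeff Z μ k).toReal * ((∫ ω, |φ (Z m ω)| ∂μ) * ∫ ω, |φ (Z (m + k) ω)| ∂μ) := by
  rw [covariance_eq_sub (h2 m) (h2 (m + k))]
  refine abs_integral_mul_sub_le (hm m) (hm (m + k)) (h2 m) (h2 (m + k)) ENNReal.toReal_nonneg
    fun s t hs ht => abs_measureReal_inter_sub_le hk (m := m) ?_ ?_ (hm m hs)
  · have : MeasurableSpace.comap (Z m) inferInstance ≤ pastSigma Z m :=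
      le_iSup₂_of_le m le_rfl le_rfl
    exact this _ ⟨φ ⁻¹' s, hφ hs, rfl⟩
  · have : MeasurableSpace.comap (Z (m + k)) inferInstance ≤ futureSigma Z (m + k) :=
      le_iSup₂_of_le (m + k) le_rfl le_rfl
    exact this _ ⟨φ ⁻¹' t, hφ ht, rfl⟩

theorem integral_abs_sq_le {U : Ω → ℝ} (hU : MemLp U 2 μ) :
    (∫ ω, |U ω| ∂μ) ^ 2 ≤ ∫ ω, U ω ^ 2 ∂μ := by
  have h := variance_nonneg (fun ω => |U ω|) μ
  rw [variance_eq_sub (X := fun ω => |U ω|) hU.abs] at h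
  have e : ∫ ω, ((fun ω => |U ω|) ^ 2) ω ∂μ = ∫ ω, U ω ^ 2 ∂μ := by simp
  linarith

/-- The mean of `n` consecutive values of a functional of a stationary ψ-mixing sequence with
summable coefficients has variance of order `1 / n`, uniformly over the functional. -/
theorem exists_lintegral_mean_sub_sq_le (hstat : IsStrictlyStationary Z μ)
    (hsum : ∑' k : ℕ, (k : ℝ≥0∞) * psiCoeff Z μ k ^ (1 / 2 : ℝ) < ∞) :
    ∃ R : ℝ≥0∞, R ≠ ∞ ∧ ∀ φ : E → ℝ, Measurable φ → (∀ i, Measurable fun ω => φ (Z i ω)) →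
      MemLp (fun ω => φ (Z 0 ω)) 2 μ → ∀ n : ℕ, 1 ≤ n →
      ∫⁻ ω, ‖(n : ℝ)⁻¹ * ∑ i ∈ Finset.range n, φ (Z i ω) - ∫ ω, φ (Z 0 ω) ∂μ‖ₑ ^ 2 ∂μ ≤
        R / n * ∫⁻ ω, ‖φ (Z 0 ω)‖ₑ ^ 2 ∂μ := by
  obtain ⟨hfin, hρ⟩ := psiCoeff_summable hsum
  set ρ : ℕ → ℝ := fun k => if k = 0 then 1 else (psiCoeff Z μ k).toReal with hρdef
  have hρ0 : ∀ k, 0 ≤ ρ k := fun k => by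
    simp only [hρdef]
    split_ifs
    · exact zero_le_one
    · exact ENNReal.toReal_nonneg
  refine ⟨ENNReal.ofReal (2 * ∑' k, ρ k), ENNReal.ofReal_ne_top, fun φ hφ hm h0 n hn => ?_⟩
  have hid : ∀ i, IdentDistrib (fun ω => φ (Z i ω)) (fun ω => φ (Z 0 ω)) μ μ := fun i => by
    have := (hstat i).comp (hφ.comp (measurable_pi_apply 0))
    simpa only [Function.comp_def, zero_add] using this
  have h2 : ∀ i, MemLp (fun ω => φ (Z i ω)) 2 μ := fun i => (hid i).memLp_iff.2 h0
  set q := ∫ ω, φ (Z 0 ω) ^ 2 ∂μ with hq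
  have hq0 : 0 ≤ q := integral_nonneg fun ω => sq_nonneg _
  have hqi : ∀ i, ∫ ω, φ (Z i ω) ^ 2 ∂μ = q := fun i => (hid i).sq.integral_eq
  have hmean : ∀ i, ∫ ω, φ (Z i ω) ∂μ = ∫ ω, φ (Z 0 ω) ∂μ := fun i => (hid i).integral_eq
  have habs : ∀ i, ∫ ω, |φ (Z i ω)| ∂μ = ∫ ω, |φ (Z 0 ω)| ∂μ := fun i => (hid i).norm.integral_eq
  have hcovlt : ∀ i k, cov[fun ω => φ (Z i ω), fun ω => φ (Z (i + (k + 1)) ω); μ]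
      ≤ ρ (k + 1) * q := by
    intro i k
    refine (le_abs_self _).trans ((abs_covariance_le_psiCoeff hφ hm h2
      (hfin (k + 1) (Nat.le_add_left _ _))).trans ?_)
    have hρk : ρ (k + 1) = (psiCoeff Z μ (k + 1)).toReal := by simp [hρdef]
    rw [habs i, habs (i + (k + 1)), hρk, ← pow_two]
    exact mul_le_mul_of_nonneg_left (integral_abs_sq_le h0) ENNReal.toReal_nonneg
  have hcov : ∀ i j, cov[fun ω => φ (Z i ω), fun ω => φ (Z j ω); μ]
      ≤ ρ (i - j + (j - i)) * q := by
    intro i j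
    rcases lt_trichotomy i j with hij | rfl | hij
    · obtain ⟨k, rfl⟩ := Nat.exists_eq_add_of_lt hij
      have e : i - (i + k + 1) + (i + k + 1 - i) = k + 1 := by omega
      rw [e]
      exact hcovlt i k
    · have e : i - i + (i - i) = 0 := by omega
      have hρz : ρ 0 = 1 := by simp [hρdef]
      rw [e, hρz, one_mul, covariance_self (hm i).aemeasurable, ← hqi i]
      exact variance_le_expectation_sq (hm i).aestronglyMeasurable
    · obtain ⟨k, rfl⟩ := Nat.exists_eq_add_of_lt hij
      have e : j + k + 1 - j + (j - (j + k + 1)) = k + 1 := by omega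
      rw [e, covariance_comm]
      exact hcovlt j k
  have hvar : Var[fun ω => (n : ℝ)⁻¹ * ∑ i ∈ Finset.range n, φ (Z i ω); μ]
      ≤ 2 * (∑' k, ρ k) / n * q := by
    rw [variance_const_mul]
    have hn0 : (0 : ℝ) < n := by exact_mod_cast hn
    have h1 : Var[fun ω => ∑ i ∈ Finset.range n, φ (Z i ω); μ] ≤ n * (2 * (∑' k, ρ k) * q) := by
      rw [variance_fun_sum' (X := fun i ω => φ (Z i ω)) fun i _ => h2 i]
      calc ∑ i ∈ Finset.range n, ∑ j ∈ Finset.range n,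
            cov[fun ω => φ (Z i ω), fun ω => φ (Z j ω); μ]
          ≤ ∑ i ∈ Finset.range n, ∑ j ∈ Finset.range n, ρ (i - j + (j - i)) * q :=
            Finset.sum_le_sum fun i _ => Finset.sum_le_sum fun j _ => hcov i j
        _ ≤ ∑ i ∈ Finset.range n, 2 * (∑' k, ρ k) * q := by
            refine Finset.sum_le_sum fun i _ => ?_
            rw [← Finset.sum_mul]
            exact mul_le_mul_of_nonneg_right (sum_range_dist_le hρ hρ0 n i) hq0
        _ = n * (2 * (∑' k, ρ k) * q) := by simp
    calc ((n : ℝ)⁻¹) ^ 2 * Var[fun ω => ∑ i ∈ Finset.range n, φ (Z i ω); μ]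
        ≤ ((n : ℝ)⁻¹) ^ 2 * (n * (2 * (∑' k, ρ k) * q)) := by gcongr
      _ = 2 * (∑' k, ρ k) / n * q := by field_simp
  have hW : MemLp (fun ω => (n : ℝ)⁻¹ * ∑ i ∈ Finset.range n, φ (Z i ω)) 2 μ :=
    (memLp_finsetSum _ fun i _ => h2 i).const_mul _
  have hWm : ∫ ω, (n : ℝ)⁻¹ * ∑ i ∈ Finset.range n, φ (Z i ω) ∂μ = ∫ ω, φ (Z 0 ω) ∂μ := by
    rw [integral_const_mul, integral_finsetSum _ fun i _ => (h2 i).integrable one_le_two]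
    simp only [hmean, Finset.sum_const, Finset.card_range, nsmul_eq_mul]
    rw [inv_mul_cancel_left₀]
    exact_mod_cast (Nat.one_le_iff_ne_zero.1 hn)
  have hev := hW.ofReal_variance_eq
  rw [evariance, hWm] at hev
  have hqe : ∫⁻ ω, ‖φ (Z 0 ω)‖ₑ ^ 2 ∂μ = ENNReal.ofReal q := by
    rw [hq, ofReal_integral_eq_lintegral_ofReal h0.integrable_sq (ae_of_all _ fun ω => sq_nonneg _)]
    refine lintegral_congr fun ω => ?_
    rw [← enorm_pow, Real.enorm_of_nonneg (sq_nonneg _)]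
  have hne : (n : ℝ≥0∞) = ENNReal.ofReal n := by simp
  rw [← hev, hqe, hne, ← ENNReal.ofReal_div_of_pos (by exact_mod_cast hn),
    ← ENNReal.ofReal_mul]
  · exact ENNReal.ofReal_le_ofReal hvar
  · have : 0 ≤ ∑' k, ρ k := tsum_nonneg hρ0
    positivity

end Mixing

section HilbertSchmidt

open scoped InnerProductSpace
open ContinuousLinearMap

variable {H H' ι κ : Type*} [NormedAddCommGroup H] [InnerProductSpace ℝ H]
  [NormedAddCommGroup H'] [InnerProductSpace ℝ H']

theorem countable_of_orthonormal [SecondCountableTopology H] {w : Set H}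
    (hw : Orthonormal ℝ ((↑) : w → H)) : w.Countable := by
  refine Set.PairwiseDisjoint.countable_of_isOpen (s := fun x : H => Metric.ball x (1 / 2)) ?_
    (fun _ _ => Metric.isOpen_ball) fun x _ => ⟨x, Metric.mem_ball_self (by norm_num)⟩
  intro x hx y hy hxy
  refine Metric.ball_disjoint_ball ?_
  have h0 : ⟪x, y⟫_ℝ = 0 := hw.2 (i := ⟨x, hx⟩) (j := ⟨y, hy⟩) fun h => hxy (congrArg Subtype.val h)
  have hx1 : ‖x‖ = 1 := hw.1 ⟨x, hx⟩
  have hy1 : ‖y‖ = 1 := hw.1 ⟨y, hy⟩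
  have h2 : ‖x - y‖ ^ 2 = 2 := by
    rw [norm_sub_sq_real, h0, hx1, hy1]
    norm_num
  rw [dist_eq_norm]
  nlinarith [norm_nonneg (x - y)]

theorem tsum_enorm_inner_sq (b : HilbertBasis ι ℝ H) (x : H) :
    ∑' i, ‖⟪x, b i⟫_ℝ‖ₑ ^ 2 = ‖x‖ₑ ^ 2 := by
  have h := b.hasSum_inner_mul_inner x x
  have e : ∀ i, ‖⟪x, b i⟫_ℝ‖ₑ ^ 2 = ENNReal.ofReal (⟪x, b i⟫_ℝ * ⟪b i, x⟫_ℝ) := fun i => by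
    rw [real_inner_comm x (b i), ← pow_two, ← enorm_pow, Real.enorm_of_nonneg (sq_nonneg _)]
  simp only [e]
  rw [← ENNReal.ofReal_tsum_of_nonneg _ h.summable, h.tsum_eq, real_inner_self_eq_norm_sq,
    ENNReal.ofReal_pow (norm_nonneg _), ofReal_norm]
  intro i
  rw [real_inner_comm x (b i)]
  exact mul_self_nonneg _

/-- The operator norm is at most the Hilbert-Schmidt norm. -/
theorem enorm_sq_le_tsum [CompleteSpace H] [CompleteSpace H'] (b : HilbertBasis ι ℝ H)
    (c : HilbertBasis κ ℝ H') (B : H →L[ℝ] H') :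
    ‖B‖ₑ ^ 2 ≤ ∑' j, ∑' i, ‖⟪c j, B (b i)⟫_ℝ‖ₑ ^ 2 := by
  set Q := ∑' j, ∑' i, ‖⟪c j, B (b i)⟫_ℝ‖ₑ ^ 2 with hQ
  have hrow : ∀ j, ∑' i, ‖⟪c j, B (b i)⟫_ℝ‖ₑ ^ 2 = ‖adjoint B (c j)‖ₑ ^ 2 := fun j => by
    simp only [← adjoint_inner_left]
    exact tsum_enorm_inner_sq b _
  have hf : ∀ f, ‖B f‖ₑ ^ 2 ≤ Q * ‖f‖ₑ ^ 2 := fun f => by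
    rw [← tsum_enorm_inner_sq c, hQ, ← ENNReal.tsum_mul_right]
    refine ENNReal.tsum_le_tsum fun j => ?_
    rw [hrow, real_inner_comm, ← adjoint_inner_left, ← mul_pow]
    gcongr
    rw [← ofReal_norm, ← ofReal_norm, ← ofReal_norm,
      ← ENNReal.ofReal_mul (norm_nonneg _)]
    exact ENNReal.ofReal_le_ofReal (norm_inner_le_norm _ _)
  rcases eq_or_ne Q ∞ with h | h
  · rw [h]
    exact le_top
  have hle : ‖B‖ ≤ √Q.toReal := by
    refine B.opNorm_le_bound (Real.sqrt_nonneg _) fun f => ?_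
    refine le_of_sq_le_sq ?_ (by positivity)
    rw [mul_pow, Real.sq_sqrt ENNReal.toReal_nonneg]
    have := ENNReal.toReal_mono (ENNReal.mul_ne_top h (by simp)) (hf f)
    simpa [ENNReal.toReal_mul, ENNReal.toReal_pow] using this
  calc ‖B‖ₑ ^ 2 = ENNReal.ofReal (‖B‖ ^ 2) := by
        rw [ENNReal.ofReal_pow (norm_nonneg _), ofReal_norm]
    _ ≤ ENNReal.ofReal (√Q.toReal ^ 2) := ENNReal.ofReal_le_ofReal (by gcongr)
    _ = Q := by rw [Real.sq_sqrt ENNReal.toReal_nonneg, ENNReal.ofReal_toReal h]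

end HilbertSchmidt

section StochasticOrder

variable {Ω : Type*} [MeasurableSpace Ω] {μ : Measure Ω} {W W' W'' : ℕ → Ω → ℝ} {a b : ℕ → ℝ}

theorem IsBigOp.mono (h : IsBigOp μ W a) {K : ℝ} (hK : 0 < K)
    (hle : ∀ n ω, |W' n ω| ≤ K * |W n ω|) : IsBigOp μ W' a := by
  intro ε hε
  obtain ⟨C, hC, h⟩ := h ε hε
  refine ⟨K * C, mul_pos hK hC, h.mono fun n hn => (measure_mono fun ω hω => ?_).trans hn⟩
  have h1 : K * C * a n < |W' n ω| := hω
  have h2 := h1.trans_le (hle n ω)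
  rw [mul_assoc] at h2
  exact lt_of_mul_lt_mul_left h2 hK.le

theorem IsBigOp.mono_right (h : IsBigOp μ W a) (hle : ∀ᶠ n in atTop, a n ≤ b n) :
    IsBigOp μ W b := by
  intro ε hε
  obtain ⟨C, hC, h⟩ := h ε hε
  refine ⟨C, hC, ?_⟩
  filter_upwards [h, hle] with n hn hab
  exact (measure_mono fun ω hω => (mul_le_mul_of_nonneg_left hab hC.le).trans_lt hω).trans hn

theorem IsBigOp.add (h : IsBigOp μ W a) (h' : IsBigOp μ W' a)
    (hle : ∀ n ω, |W'' n ω| ≤ |W n ω| + |W' n ω|) : IsBigOp μ W'' a := by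
  intro ε hε
  obtain ⟨C, hC, h⟩ := h (ε / 2) (ENNReal.half_pos hε.ne')
  obtain ⟨C', hC', h'⟩ := h' (ε / 2) (ENNReal.half_pos hε.ne')
  refine ⟨C + C', add_pos hC hC', ?_⟩
  filter_upwards [h, h'] with n hn hn'
  calc μ {ω | (C + C') * a n < |W'' n ω|}
      ≤ μ ({ω | C * a n < |W n ω|} ∪ {ω | C' * a n < |W' n ω|}) := by
        refine measure_mono fun ω hω => ?_
        have h1 : (C + C') * a n < |W'' n ω| := hω
        by_contra hcon
        simp only [Set.mem_union, Set.mem_ofPred_eq, not_or, not_lt] at hcon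
        linarith [hle n ω, hcon.1, hcon.2]
    _ ≤ ε / 2 + ε / 2 := (measure_union_le _ _).trans (add_le_add hn hn')
    _ = ε := ENNReal.add_halves ε

theorem IsBigOp.mul (h : IsBigOp μ W a) (h' : IsBigOp μ W' b) (ha : ∀ n, 0 ≤ a n) :
    IsBigOp μ (fun n ω => W n ω * W' n ω) (fun n => a n * b n) := by
  intro ε hε
  obtain ⟨C, hC, h⟩ := h (ε / 2) (ENNReal.half_pos hε.ne')
  obtain ⟨C', hC', h'⟩ := h' (ε / 2) (ENNReal.half_pos hε.ne')
  refine ⟨C * C', mul_pos hC hC', ?_⟩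
  filter_upwards [h, h'] with n hn hn'
  calc μ {ω | C * C' * (a n * b n) < |W n ω * W' n ω|}
      ≤ μ ({ω | C * a n < |W n ω|} ∪ {ω | C' * b n < |W' n ω|}) := by
        refine measure_mono fun ω hω => ?_
        have h1 : C * C' * (a n * b n) < |W n ω * W' n ω| := hω
        by_contra hcon
        simp only [Set.mem_union, Set.mem_ofPred_eq, not_or, not_lt] at hcon
        rw [abs_mul] at h1
        have := mul_le_mul hcon.1 hcon.2 (abs_nonneg _) (mul_nonneg hC.le (ha n))
        linarith
    _ ≤ ε / 2 + ε / 2 := (measure_union_le _ _).trans (add_le_add hn hn')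
    _ = ε := ENNReal.add_halves ε

theorem rpow_neg_half_sq (n : ℕ) : ((n : ℝ) ^ (-(1 / 2) : ℝ)) ^ 2 = (n : ℝ)⁻¹ := by
  rw [← Real.rpow_natCast, ← Real.rpow_mul (Nat.cast_nonneg n)]
  norm_num
  rw [Real.rpow_neg_one]

/-- Markov's inequality in terms of stochastic orders. -/
theorem isBigOp_of_lintegral_sq_le {Q : ℕ → Ω → ℝ≥0∞} {c : ℝ≥0∞} (hc : c ≠ ∞)
    (hWQ : ∀ n ω, ‖W n ω‖ₑ ^ 2 ≤ Q n ω) (hQm : ∀ n, AEMeasurable (Q n) μ)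
    (hQ : ∀ n : ℕ, 1 ≤ n → ∫⁻ ω, Q n ω ∂μ ≤ c / n) :
    IsBigOp μ W (fun n => (n : ℝ) ^ (-(1 / 2) : ℝ)) := by
  intro ε hε
  obtain ⟨C, hC, hCε⟩ : ∃ C : ℝ, 0 < C ∧ c ≤ ε * ENNReal.ofReal (C ^ 2) := by
    rcases eq_or_ne ε ∞ with rfl | hεt
    · exact ⟨1, one_pos, by simp⟩
    have hε' : 0 < ε.toReal := ENNReal.toReal_pos hε.ne' hεt
    have hc0 : 0 ≤ c.toReal := ENNReal.toReal_nonneg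
    refine ⟨c.toReal / ε.toReal + 1, by positivity, ?_⟩
    rw [← ENNReal.ofReal_toReal hc, ← ENNReal.ofReal_toReal hεt, ← ENNReal.ofReal_mul hε'.le]
    refine ENNReal.ofReal_le_ofReal ?_
    simp only [ENNReal.toReal_ofReal hc0, ENNReal.toReal_ofReal hε'.le]
    have hq : 0 ≤ c.toReal / ε.toReal := by positivity
    calc c.toReal = ε.toReal * (c.toReal / ε.toReal) := by field_simp
      _ ≤ ε.toReal * (c.toReal / ε.toReal + 1) ^ 2 := by
        gcongr
        nlinarith
  refine ⟨C, hC, ?_⟩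
  filter_upwards [eventually_ge_atTop 1] with n hn
  have hn0 : (0 : ℝ) < n := by exact_mod_cast hn
  have hC2 : 0 < C ^ 2 * (n : ℝ)⁻¹ := by positivity
  calc μ {ω | C * (n : ℝ) ^ (-(1 / 2) : ℝ) < |W n ω|}
      ≤ μ {ω | ENNReal.ofReal (C ^ 2 * (n : ℝ)⁻¹) ≤ Q n ω} := by
        refine measure_mono fun ω hω => ?_
        have h1 : C * (n : ℝ) ^ (-(1 / 2) : ℝ) < |W n ω| := hω
        have h2 := pow_le_pow_left₀ (by positivity) h1.le 2
        rw [mul_pow, rpow_neg_half_sq, sq_abs] at h2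
        refine (ENNReal.ofReal_le_ofReal h2).trans ?_
        rw [← Real.enorm_of_nonneg (sq_nonneg _), enorm_pow]
        exact hWQ n ω
    _ ≤ (∫⁻ ω, Q n ω ∂μ) / ENNReal.ofReal (C ^ 2 * (n : ℝ)⁻¹) :=
        meas_ge_le_lintegral_div (hQm n) (ENNReal.ofReal_pos.2 hC2).ne' ENNReal.ofReal_ne_top
    _ ≤ ε := by
        refine ENNReal.div_le_of_le_mul ((hQ n hn).trans ?_)
        rw [ENNReal.ofReal_mul (sq_nonneg C), ENNReal.ofReal_inv_of_pos hn0, ENNReal.ofReal_natCast,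
          ← mul_assoc, div_eq_mul_inv]
        gcongr

end StochasticOrder

section Estimation

open scoped InnerProductSpace
open ContinuousLinearMap InnerProductSpace

theorem measurable_inner_right {S : Type*} [MeasureSpace S] (e : L2 S) :
    Measurable fun y : L2 S => ⟪y, e⟫_ℝ :=
  (continuous_id.inner continuous_const).measurable

variable {Ω S T E : Type*} [MeasurableSpace Ω] [MeasureSpace S] [MeasureSpace T]
  [IsFiniteMeasure (volume : Measure S)] [IsFiniteMeasure (volume : Measure T)]
  [SecondCountableTopology (L2 S)] [SecondCountableTopology (L2 T)]
  [MeasurableSpace E] {μ : Measure Ω} [IsProbabilityMeasure μ] {Z : ℕ → Ω → E}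

theorem isBigOp_norm_meanL2 (hstat : IsStrictlyStationary Z μ)
    (hsum : ∑' k : ℕ, (k : ℝ≥0∞) * psiCoeff Z μ k ^ (1 / 2 : ℝ) < ∞)
    {W : ℕ → RandomCurve Ω S} {p : E → L2 S} (hp : Measurable p)
    (hpZ : ∀ i ω, p (Z i ω) = (W i).toL2 ω) (hmean : ∀ u, ∫ ω, W 0 ω u ∂μ = 0)
    (hmom : ∫⁻ ω, ‖(W 0).toL2 ω‖ₑ ^ 2 ∂μ < ∞) :
    IsBigOp μ (fun n ω => ‖meanL2 W n ω‖) (fun n => (n : ℝ) ^ (-(1 / 2) : ℝ)) := by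
  obtain ⟨R, hR, hmix⟩ := exists_lintegral_mean_sub_sq_le hstat hsum
  obtain ⟨w, b, hb⟩ := exists_hilbertBasis ℝ (L2 S)
  have : Countable w := (countable_of_orthonormal (hb ▸ b.orthonormal)).to_subtype
  have hmeas : ∀ i e, Measurable fun ω => ⟪(W i).toL2 ω, e⟫_ℝ := fun i e =>
    measurable_inner_toL2 (W i) e
  have hterm : ∀ n ω e, ⟪meanL2 W n ω, e⟫_ℝ
      = (n : ℝ)⁻¹ * ∑ i ∈ Finset.range n, ⟪(W i).toL2 ω, e⟫_ℝ := fun n ω e => by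
    rw [meanL2, real_inner_smul_left, sum_inner]
  have hmeasn : ∀ n e, Measurable fun ω => ⟪meanL2 W n ω, e⟫_ℝ := fun n e => by
    simp only [hterm]
    exact (Finset.measurable_sum _ fun i _ => hmeas i e).const_mul _
  refine isBigOp_of_lintegral_sq_le (Q := fun n ω => ∑' a, ‖⟪meanL2 W n ω, b a⟫_ℝ‖ₑ ^ 2)
    (c := R * ∫⁻ ω, ‖(W 0).toL2 ω‖ₑ ^ 2 ∂μ) (ENNReal.mul_ne_top hR hmom.ne) ?_ ?_ ?_
  · intro n ω
    rw [tsum_enorm_inner_sq, enorm_norm]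
  · exact fun n => (Measurable.tsum fun a => (hmeasn n (b a)).enorm.pow_const 2).aemeasurable
  intro n hn
  rw [lintegral_tsum fun a => ((hmeasn n (b a)).enorm.pow_const 2).aemeasurable]
  calc ∑' a, ∫⁻ ω, ‖⟪meanL2 W n ω, b a⟫_ℝ‖ₑ ^ 2 ∂μ
      ≤ ∑' a, R / n * ∫⁻ ω, ‖⟪(W 0).toL2 ω, b a⟫_ℝ‖ₑ ^ 2 ∂μ := by
        refine ENNReal.tsum_le_tsum fun a => ?_
        have hL2 : MemLp (fun ω => ⟪(W 0).toL2 ω, b a⟫_ℝ) 2 μ := by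
          refine memLp_two_of_lintegral_lt_top (hmeas 0 _).aestronglyMeasurable
            ((lintegral_mono fun ω => ?_).trans_lt hmom)
          rw [← tsum_enorm_inner_sq b]
          exact ENNReal.le_tsum a
        have key := hmix (fun x => ⟪p x, b a⟫_ℝ) ((measurable_inner_right (b a)).comp hp)
          (fun i => by simpa only [hpZ] using hmeas i (b a)) (by simpa only [hpZ] using hL2) n hn
        simp only [hpZ] at key
        rw [integral_inner_toL2_eq_zero hmom hmean] at key
        simpa only [sub_zero, ← hterm] using key
    _ = R / n * ∫⁻ ω, ‖(W 0).toL2 ω‖ₑ ^ 2 ∂μ := by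
        rw [ENNReal.tsum_mul_left,
          ← lintegral_tsum fun a => ((hmeas 0 (b a)).enorm.pow_const 2).aemeasurable]
        simp only [tsum_enorm_inner_sq]
    _ = R * (∫⁻ ω, ‖(W 0).toL2 ω‖ₑ ^ 2 ∂μ) / n := by
        rw [div_eq_mul_inv, div_eq_mul_inv]
        ring

variable {Y : ℕ → RandomCurve Ω S} {X : ℕ → RandomCurve Ω T}

theorem isBigOp_norm_mean_rankOne_sub (hstat : IsStrictlyStationary (curvePair Y X) μ)
    (hsum : ∑' k : ℕ, (k : ℝ≥0∞) * psiCoeff (curvePair Y X) μ k ^ (1 / 2 : ℝ) < ∞)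
    (hY : AEStronglyMeasurable (Y 0).toL2 μ) (hX : AEStronglyMeasurable (X 0).toL2 μ)
    (hmom : ∫⁻ ω, ‖(Y 0).toL2 ω‖ₑ ^ 2 * ‖(X 0).toL2 ω‖ₑ ^ 2 ∂μ < ∞) :
    IsBigOp μ (fun n ω => ‖(n : ℝ)⁻¹ • ∑ i ∈ Finset.range n,
        rankOne ℝ ((X i).toL2 ω) ((Y i).toL2 ω) - covOp μ (Y 0) (X 0)‖)
      (fun n => (n : ℝ) ^ (-(1 / 2) : ℝ)) := by
  obtain ⟨R, hR, hmix⟩ := exists_lintegral_mean_sub_sq_le hstat hsum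
  obtain ⟨w, b, hb⟩ := exists_hilbertBasis ℝ (L2 S)
  have : Countable w := (countable_of_orthonormal (hb ▸ b.orthonormal)).to_subtype
  obtain ⟨w', c, hc⟩ := exists_hilbertBasis ℝ (L2 T)
  have : Countable w' := (countable_of_orthonormal (hc ▸ c.orthonormal)).to_subtype
  set D : ℕ → Ω → L2 S →L[ℝ] L2 T := fun n ω => (n : ℝ)⁻¹ • ∑ i ∈ Finset.range n,
        rankOne ℝ ((X i).toL2 ω) ((Y i).toL2 ω) - covOp μ (Y 0) (X 0) with hD
  have hmeas : ∀ i e f, Measurable fun ω => ⟪(Y i).toL2 ω, e⟫_ℝ * ⟪(X i).toL2 ω, f⟫_ℝ :=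
    fun i e f => (measurable_inner_toL2 (Y i) e).mul (measurable_inner_toL2 (X i) f)
  have hterm : ∀ n ω e f, ⟪f, D n ω e⟫_ℝ
      = (n : ℝ)⁻¹ * ∑ i ∈ Finset.range n, ⟪(Y i).toL2 ω, e⟫_ℝ * ⟪(X i).toL2 ω, f⟫_ℝ
        - ∫ ω, ⟪(Y 0).toL2 ω, e⟫_ℝ * ⟪(X 0).toL2 ω, f⟫_ℝ ∂μ := fun n ω e f => by
    simp only [hD, sub_apply, smul_apply, sum_apply, inner_sub_right, real_inner_smul_right,
      inner_sum, rankOne_apply]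
    rw [inner_covOp hY hX hmom]
    simp only [real_inner_comm]
  have hmeasn : ∀ n e f, Measurable fun ω => ⟪f, D n ω e⟫_ℝ := fun n e f => by
    simp only [hterm]
    exact ((Finset.measurable_sum _ fun i _ => hmeas i e f).const_mul _).sub_const _
  have hpars : ∀ ω, ∑' k, ∑' a, ‖⟪(Y 0).toL2 ω, b a⟫_ℝ * ⟪(X 0).toL2 ω, c k⟫_ℝ‖ₑ ^ 2
      = ‖(Y 0).toL2 ω‖ₑ ^ 2 * ‖(X 0).toL2 ω‖ₑ ^ 2 := fun ω => by
    simp only [enorm_mul, mul_pow, ENNReal.tsum_mul_right, ENNReal.tsum_mul_left,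
      tsum_enorm_inner_sq]
  refine isBigOp_of_lintegral_sq_le (Q := fun n ω => ∑' k, ∑' a, ‖⟪c k, D n ω (b a)⟫_ℝ‖ₑ ^ 2)
    (c := R * ∫⁻ ω, ‖(Y 0).toL2 ω‖ₑ ^ 2 * ‖(X 0).toL2 ω‖ₑ ^ 2 ∂μ)
    (ENNReal.mul_ne_top hR hmom.ne) ?_ ?_ ?_
  · intro n ω
    rw [enorm_norm]
    exact enorm_sq_le_tsum b c _
  · exact fun n => (Measurable.tsum fun k => Measurable.tsum fun a =>
      (hmeasn n (b a) (c k)).enorm.pow_const 2).aemeasurable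
  intro n hn
  rw [lintegral_tsum fun k => (Measurable.tsum fun a =>
      (hmeasn n (b a) (c k)).enorm.pow_const 2).aemeasurable]
  calc ∑' k, ∫⁻ ω, ∑' a, ‖⟪c k, D n ω (b a)⟫_ℝ‖ₑ ^ 2 ∂μ
      ≤ ∑' k, R / n * ∫⁻ ω, ∑' a, ‖⟪(Y 0).toL2 ω, b a⟫_ℝ * ⟪(X 0).toL2 ω, c k⟫_ℝ‖ₑ ^ 2 ∂μ := by
        refine ENNReal.tsum_le_tsum fun k => ?_
        rw [lintegral_tsum fun a => ((hmeasn n (b a) (c k)).enorm.pow_const 2).aemeasurable,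
          lintegral_tsum fun a => ((hmeas 0 (b a) (c k)).enorm.pow_const 2).aemeasurable,
          ← ENNReal.tsum_mul_left]
        refine ENNReal.tsum_le_tsum fun a => ?_
        have hL2 : MemLp (fun ω => ⟪(Y 0).toL2 ω, b a⟫_ℝ * ⟪(X 0).toL2 ω, c k⟫_ℝ) 2 μ := by
          refine memLp_two_of_lintegral_lt_top (hmeas 0 _ _).aestronglyMeasurable
            ((lintegral_mono fun ω => ?_).trans_lt hmom)
          rw [← hpars]
          exact (ENNReal.le_tsum (f := fun a =>
            ‖⟪(Y 0).toL2 ω, b a⟫_ℝ * ⟪(X 0).toL2 ω, c k⟫_ℝ‖ₑ ^ 2) a).trans (ENNReal.le_tsum (f :=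
            fun k => ∑' a, ‖⟪(Y 0).toL2 ω, b a⟫_ℝ * ⟪(X 0).toL2 ω, c k⟫_ℝ‖ₑ ^ 2) k)
        have key := hmix (fun x => ⟪x.1, b a⟫_ℝ * ⟪x.2, c k⟫_ℝ)
          (((measurable_inner_right (b a)).comp measurable_fst).mul
            ((measurable_inner_right (c k)).comp measurable_snd))
          (fun i => hmeas i (b a) (c k)) hL2 n hn
        simp only [hterm]
        exact key
    _ = R / n * ∫⁻ ω, ‖(Y 0).toL2 ω‖ₑ ^ 2 * ‖(X 0).toL2 ω‖ₑ ^ 2 ∂μ := by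
        rw [ENNReal.tsum_mul_left, ← lintegral_tsum fun k => (Measurable.tsum fun a =>
          (hmeas 0 (b a) (c k)).enorm.pow_const 2).aemeasurable]
        simp only [hpars]
    _ = R * (∫⁻ ω, ‖(Y 0).toL2 ω‖ₑ ^ 2 * ‖(X 0).toL2 ω‖ₑ ^ 2 ∂μ) / n := by
        rw [div_eq_mul_inv, div_eq_mul_inv]
        ring

theorem rpow_neg_half_mul_self (n : ℕ) :
    (n : ℝ) ^ (-(1 / 2) : ℝ) * (n : ℝ) ^ (-(1 / 2) : ℝ) = (n : ℝ) ^ (-1 : ℝ) := by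
  rw [← pow_two, rpow_neg_half_sq, Real.rpow_neg_one]

theorem rpow_neg_one_le_rpow_neg_half :
    ∀ᶠ n : ℕ in atTop, (n : ℝ) ^ (-1 : ℝ) ≤ (n : ℝ) ^ (-(1 / 2) : ℝ) := by
  filter_upwards [eventually_ge_atTop 1] with n hn
  exact Real.rpow_le_rpow_of_exponent_le (by exact_mod_cast hn) (by norm_num)

/-- The singular values of the sample covariance converge at the parametric rate. -/
theorem isBigOp_sqrt_lamHat_sub (hYmean : ∀ i u, ∫ ω, Y i ω u ∂μ = 0)
    (hXmean : ∀ i v, ∫ ω, X i ω v ∂μ = 0) (hstat : IsStrictlyStationary (curvePair Y X) μ)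
    (hsum : ∑' k : ℕ, (k : ℝ≥0∞) * psiCoeff (curvePair Y X) μ k ^ (1 / 2 : ℝ) < ∞)
    (hmom : ∫⁻ ω, ((∫⁻ u, ‖Y 0 ω u‖ₑ ^ 2) + ∫⁻ v, ‖X 0 ω v‖ₑ ^ 2) ^ 2 ∂μ < ∞) {k : ℕ}
    (hk : 1 ≤ k) :
    IsBigOp μ (fun n ω => √(lamHat Y X n k ω) - √(lam μ (Y 0) (X 0) k))
      (fun n => (n : ℝ) ^ (-(1 / 2) : ℝ)) := by
  have hZ : AEMeasurable (fun ω => curvePair Y X 0 ω) μ :=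
    (measurable_pi_apply 0).comp_aemeasurable (hstat 0).aemeasurable_snd
  have hY : AEStronglyMeasurable (Y 0).toL2 μ :=
    (measurable_fst.comp_aemeasurable hZ).aestronglyMeasurable
  have hX : AEStronglyMeasurable (X 0).toL2 μ :=
    (measurable_snd.comp_aemeasurable hZ).aestronglyMeasurable
  have hprod := lintegral_prod_sq_lt_top hmom
  have h1 := isBigOp_norm_mean_rankOne_sub hstat hsum hY hX hprod
  have h2 := isBigOp_norm_meanL2 hstat hsum (W := X) (p := Prod.snd) measurable_snd
    (fun _ _ => rfl) (hXmean 0) (lintegral_sq_lt_top_right hmom)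
  have h3 := isBigOp_norm_meanL2 hstat hsum (W := Y) (p := Prod.fst) measurable_fst
    (fun _ _ => rfl) (hYmean 0) (lintegral_sq_lt_top_left hmom)
  have h4 := h2.mul h3 fun n => Real.rpow_nonneg (Nat.cast_nonneg n) _
  simp only [rpow_neg_half_mul_self] at h4
  refine h1.add (h4.mono_right rpow_neg_one_le_rpow_neg_half) fun n ω => ?_
  rw [lamHat, lam, (isKernelOf_sampleCovOp Y X n ω).kthEigenvalue_eq,
    (isKernelOf_covOp hY hX hprod (hYmean 0) (hXmean 0)).kthEigenvalue_eq]
  refine (abs_sqrt_opEigenvalue_sub_le _ _ (isCompactOperator_sampleCovOp Y X n ω)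
    (isCompactOperator_covOp hY hX hprod) hk).trans ?_
  rw [abs_norm, abs_mul, abs_norm, abs_norm, ← norm_rankOne (𝕜 := ℝ), sampleCovOp, sub_right_comm]
  exact norm_sub_le _ _

end Estimation

theorem isFiniteMeasure_volume_subtype {s : Set ℝ} (hs : IsCompact s) :
    IsFiniteMeasure (volume : Measure s) := by
  refine ⟨?_⟩
  rw [Measure.Subtype.volume_univ hs.measurableSet.nullMeasurableSet]
  exact hs.measure_lt_top

theorem lam_nonneg {Ω S T : Type*} [MeasurableSpace Ω] [MeasureSpace S] [MeasureSpace T]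
    (μ : Measure Ω) (Y : RandomCurve Ω S) (X : RandomCurve Ω T) (k : ℕ) : 0 ≤ lam μ Y X k :=
  Real.sSup_nonneg fun _ ht => ht.1.le

theorem lamHat_nonneg {Ω S T : Type*} [MeasurableSpace Ω] [MeasureSpace S] [MeasureSpace T]
    (Y : ℕ → RandomCurve Ω S) (X : ℕ → RandomCurve Ω T) (n k : ℕ) (ω : Ω) :
    0 ≤ lamHat Y X n k ω :=
  Real.sSup_nonneg fun _ ht => ht.1.le

end CurveRegression

open CurveRegression
theorem proposition1 {Ω : Type*} [MeasurableSpace Ω] (μ : Measure Ω) [IsProbabilityMeasure μ]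
    (I₁ I₂ : Set ℝ) (hI₁ : IsCompact I₁) (hI₂ : IsCompact I₂)
    (Y : ℕ → RandomCurve Ω I₁) (X : ℕ → RandomCurve Ω I₂)
    (hYmean : ∀ i u, ∫ ω, Y i ω u ∂μ = 0)
    (hXmean : ∀ i v, ∫ ω, X i ω v ∂μ = 0)
    (hstat : IsStrictlyStationary (curvePair Y X) μ)
    (hmix : IsPsiMixing (curvePair Y X) μ)
    (hsum : ∑' k : ℕ, (k : ℝ≥0∞) * psiCoeff (curvePair Y X) μ k ^ (1 / 2 : ℝ) < ∞)
    (hmom : ∀ i, ∫⁻ ω, ((∫⁻ u, ‖Y i ω u‖ₑ ^ 2) + ∫⁻ v, ‖X i ω v‖ₑ ^ 2) ^ 2 ∂μ < ∞)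
    (r : ℕ)
    (hpos : ∀ k, 1 ≤ k → k ≤ r → 0 < lam μ (Y 0) (X 0) k)
    (hdist : ∀ k, 1 ≤ k → k < r → lam μ (Y 0) (X 0) (k + 1) < lam μ (Y 0) (X 0) k)
    (hzero : ∀ k, r < k → lam μ (Y 0) (X 0) k = 0) :
    (∀ k, 1 ≤ k → k ≤ r →
      IsBigOp μ (fun n ω => |lamHat Y X n k ω - lam μ (Y 0) (X 0) k|)
        (fun n => (n : ℝ) ^ (-(1 / 2) : ℝ))) ∧
    (∀ k, r < k →
      IsBigOp μ (fun n ω => |lamHat Y X n k ω|) (fun n => (n : ℝ) ^ (-1 : ℝ))) := by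
  have := isFiniteMeasure_volume_subtype hI₁
  have := isFiniteMeasure_volume_subtype hI₂
  have : Fact ((2 : ℝ≥0∞) ≠ ∞) := ⟨by norm_num⟩
  have main : ∀ k, 1 ≤ k → IsBigOp μ
      (fun n ω => √(lamHat Y X n k ω) - √(lam μ (Y 0) (X 0) k))
      (fun n => (n : ℝ) ^ (-(1 / 2) : ℝ)) := fun k hk =>
    isBigOp_sqrt_lamHat_sub hYmean hXmean hstat hsum (hmom 0) hk
  have main_sq : ∀ k, 1 ≤ k → IsBigOp μ
      (fun n ω => (√(lamHat Y X n k ω) - √(lam μ (Y 0) (X 0) k))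
        * (√(lamHat Y X n k ω) - √(lam μ (Y 0) (X 0) k)))
      (fun n => (n : ℝ) ^ (-1 : ℝ)) := fun k hk => by
    have := (main k hk).mul (main k hk) fun n => Real.rpow_nonneg (Nat.cast_nonneg n) _
    simpa only [rpow_neg_half_mul_self] using this
  refine ⟨fun k hk _ => ?_, fun k hk => ?_⟩
  · have hl := lam_nonneg μ (Y 0) (X 0) k
    have hlin : IsBigOp μ (fun n ω => 2 * √(lam μ (Y 0) (X 0) k) *
        (√(lamHat Y X n k ω) - √(lam μ (Y 0) (X 0) k))) (fun n => (n : ℝ) ^ (-(1 / 2) : ℝ)) := by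
      refine (main k hk).mono (K := 2 * √(lam μ (Y 0) (X 0) k) + 1) (by positivity) fun n ω => ?_
      rw [abs_mul, abs_of_nonneg (by positivity)]
      exact mul_le_mul_of_nonneg_right (by linarith) (abs_nonneg _)
    refine ((main_sq k hk).mono_right rpow_neg_one_le_rpow_neg_half).add hlin fun n ω => ?_
    have e1 := Real.mul_self_sqrt hl
    have e2 := Real.mul_self_sqrt (lamHat_nonneg Y X n k ω)
    have e : lamHat Y X n k ω - lam μ (Y 0) (X 0) k =
        (√(lamHat Y X n k ω) - √(lam μ (Y 0) (X 0) k))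
          * (√(lamHat Y X n k ω) - √(lam μ (Y 0) (X 0) k))
        + 2 * √(lam μ (Y 0) (X 0) k) * (√(lamHat Y X n k ω) - √(lam μ (Y 0) (X 0) k)) := by
      nlinarith
    rw [abs_abs, e]
    exact abs_add_le _ _
  · refine (main_sq k (Nat.one_le_of_lt hk)).mono one_pos fun n ω => ?_
    rw [hzero k hk, Real.sqrt_zero, sub_zero, Real.mul_self_sqrt (lamHat_nonneg Y X n k ω), abs_abs,
      one_mul]
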